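/- Theorem (Unisolvence for $\mathcal{P}_r^-\Lambda^k$). Let $r\ge 1$ and $0\le k\le n$ be integers and let $T\subset\mathbb{R}^n$ be an $n$-simplex. For a simplex $f$ (with its tangent space, the direction of its affine span), let $\mathcal{P}_s\Lambda^j(f)$ be the space of differential $j$-forms on $f$ whose coefficients are restrictions to $f$ of polynomials of degree at most $s$ (it is $0$ if $s<0$; on a vertex, the polynomial functions of degree at most $s\ge 0$ are the constants). Let $\mathcal{H}_s\Lambda^j$ be the space of $j$-forms on $T$ whose coefficients are homogeneous polynomials of degree $s$ in the coordinates of $\mathbb{R}^n$, and let $\kappa$ be the Koszul differential $(\kappa\omega)_x(v_1,\dots,v_j)=\omega_x(x,v_1,\dots,v_j)$, which takes $(j+1)$-forms to $j$-forms. Put $$\mathcal{P}_r^-\Lambda^k(T)=\mathcal{P}_{r-1}\Lambda^k(T)+\kappa\,\mathcal{H}_{r-1}\Lambda^{k+1}.$$ For every face $f$ of $T$ of dimension $d$ with $k\le d\le n$, fix an orientation of $f$ (on which the integral of $d$-forms over $f$ depends by a sign only), let $\operatorname{tr}_f$ denote the trace, i.e. the pullback of forms by the inclusion $f\hookrightarrow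 T$, and choose any basis $(q_{f,i})_i$ of $\mathcal{P}_{r+k-d-1}\Lambda^{d-k}(f)$. Then the functionals $$u\mapsto\int_f(\operatorname{tr}_f u)\wedge q_{f,i},$$ with $f$ ranging over all faces of $T$ of dimension $d\ge k$ and $q_{f,i}$ over the chosen basis for $f$, form a basis of the dual space $\mathcal{P}_r^-\Lambda^k(T)^*$. -/

import Mathlib

open MeasureTheory

noncomputable section

namespace FEForms

/-- Euclidean space `ℝⁿ`. -/
abbrev E (n : ℕ) := EuclideanSpace ℝ (Fin n)

/-- Differential `k`-forms on a set `X ⊆ ℝⁿ` whose tangent space at each of its points is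
(identified with) the vector space `W`: maps assigning to a point of `X` an element of
`Altᵏ W`. -/
abbrev DForm {n : ℕ} (X : Set (E n)) (W : Type*) [AddCommGroup W] [Module ℝ W] (k : ℕ) :=
  X → W [⋀^Fin k]→ₗ[ℝ] ℝ

/-- The form `p • α` on `X`, with coefficient the polynomial `p` in the coordinates of `ℝⁿ`
(restricted to `X`) and `α` a constant alternating form. -/
def polyTerm {n : ℕ} (X : Set (E n)) {W : Type*} [AddCommGroup W] [Module ℝ W] {k : ℕ}
    (p : MvPolynomial (Fin n) ℝ) (α : W [⋀^Fin k]→ₗ[ℝ] ℝ) : DForm X W k :=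
  fun x => MvPolynomial.eval (fun i => (x : E n) i) p • α

/-- `𝒫_s Λᵏ(X)`: the `k`-forms on `X` with polynomial coefficients of degree at most `s`.
It is `0` when `s < 0`. -/
def polyForms {n : ℕ} (X : Set (E n)) (W : Type*) [AddCommGroup W] [Module ℝ W]
    (s : ℤ) (k : ℕ) : Submodule ℝ (DForm X W k) :=
  Submodule.span ℝ
    {ω | ∃ (p : MvPolynomial (Fin n) ℝ) (α : W [⋀^Fin k]→ₗ[ℝ] ℝ),
      (p.totalDegree : ℤ) ≤ s ∧ ω = polyTerm X p α}

/-- `ℋ_s Λᵏ(X)`: the `k`-forms on `X` whose coefficients are homogeneous polynomials of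
degree `s`. -/
def homogForms {n : ℕ} (X : Set (E n)) (W : Type*) [AddCommGroup W] [Module ℝ W]
    (s : ℕ) (k : ℕ) : Submodule ℝ (DForm X W k) :=
  Submodule.span ℝ
    {ω | ∃ (p : MvPolynomial (Fin n) ℝ) (α : W [⋀^Fin k]→ₗ[ℝ] ℝ),
      p.IsHomogeneous s ∧ ω = polyTerm X p α}

/-- The Koszul differential: `(κω)ₓ(v₁,…,vₖ) = ωₓ(x,v₁,…,vₖ)`. -/
def koszul {n : ℕ} (X : Set (E n)) (k : ℕ) :
    DForm X (E n) (k + 1) →ₗ[ℝ] DForm X (E n) k where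
  toFun ω := fun x => (ω x).curryLeft (x : E n)
  map_add' _ _ := rfl
  map_smul' _ _ := rfl

/-- `𝒫_r⁻ Λᵏ(X) = 𝒫_{r-1} Λᵏ(X) + κ ℋ_{r-1} Λᵏ⁺¹(X)`, for `r ≥ 1`. -/
def polyMinusForms {n : ℕ} (X : Set (E n)) (r k : ℕ) : Submodule ℝ (DForm X (E n) k) :=
  polyForms X (E n) ((r : ℤ) - 1) k ⊔ (homogForms X (E n) (r - 1) (k + 1)).map (koszul X k)

/-- The wedge product of alternating forms,
`(ω ∧ μ)(v₁,…,v_{k+l}) = ∑ sign(σ) ω(v_{σ(1)},…,v_{σ(k)}) μ(v_{σ(k+1)},…,v_{σ(k+l)})`,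
the sum being over the `(k,l)`-shuffles `σ` (equivalently `binom(k+l,k) skew(ω ⊗ μ)`). -/
def wedge {W : Type*} [AddCommGroup W] [Module ℝ W] {k l : ℕ}
    (ω : W [⋀^Fin k]→ₗ[ℝ] ℝ) (μ : W [⋀^Fin l]→ₗ[ℝ] ℝ) : W [⋀^Fin (k + l)]→ₗ[ℝ] ℝ :=
  ((LinearMap.mul' ℝ ℝ).compAlternatingMap (ω.domCoprod μ)).domDomCongr finSumFinEquiv

/-- The tangent space of a `d`-simplex in `ℝⁿ`: the direction of its affine span. -/
abbrev tangent {n d : ℕ} (S : Affine.Simplex ℝ (E n) d) : Submodule ℝ (E n) :=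
  vectorSpan ℝ (Set.range S.points)

/-- The trace on a set `Y ⊆ X` with tangent space `W` of a form on a domain `X` of `ℝⁿ`: the
pullback by the inclusion. -/
def trace {n k : ℕ} {X Y : Set (E n)} (h : Y ⊆ X) (W : Submodule ℝ (E n))
    (u : DForm X (E n) k) : DForm Y W k :=
  fun y => (u ⟨y, h y.2⟩).compLinearMap W.subtype

/-- The edge vectors `vᵢ - v₀`, `1 ≤ i ≤ d`, of a simplex with vertices `v₀,…,v_d`. -/
def frame {n d : ℕ} (S : Affine.Simplex ℝ (E n) d) (i : Fin d) : tangent S :=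
  ⟨S.points i.succ -ᵥ S.points 0,
    vsub_mem_vectorSpan ℝ (Set.mem_range_self _) (Set.mem_range_self _)⟩

/-- The reference simplex `{t ∈ ℝᵈ | tᵢ ≥ 0, ∑ tᵢ ≤ 1}`. -/
def refSimplex (d : ℕ) : Set (Fin d → ℝ) := {t | (∀ i, 0 ≤ t i) ∧ ∑ i, t i ≤ 1}

theorem param_mem {n d : ℕ} (S : Affine.Simplex ℝ (E n) d) (t : refSimplex d) :
    S.points 0 + ∑ i, (t : Fin d → ℝ) i • (frame S i : E n) ∈ S.closedInterior := by
  rw [← Affine.Simplex.convexHull_eq_closedInterior]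
  have key : S.points 0 + ∑ i, (t : Fin d → ℝ) i • (frame S i : E n)
      = ∑ j, (Fin.cons (1 - ∑ i, (t : Fin d → ℝ) i) (t : Fin d → ℝ) : Fin (d + 1) → ℝ) j
          • S.points j := by
    rw [Fin.sum_univ_succ]
    simp only [Fin.cons_zero, Fin.cons_succ, frame, vsub_eq_sub, smul_sub,
      Finset.sum_sub_distrib, sub_smul, one_smul, Finset.sum_smul]
    abel
  rw [key]
  refine (convex_convexHull ℝ _).sum_mem ?_ ?_ ?_
  · intro j _
    refine Fin.cases ?_ (fun i => ?_) j
    · simpa using t.2.2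
    · simpa using t.2.1 i
  · simp [Fin.sum_univ_succ]
  · intro j _
    exact subset_convexHull ℝ _ (Set.mem_range_self j)

/-- The affine parametrization `t ↦ v₀ + ∑ tᵢ (vᵢ - v₀)` of a simplex over the reference
simplex. -/
def param {n d : ℕ} (S : Affine.Simplex ℝ (E n) d) (t : refSimplex d) : S.closedInterior :=
  ⟨S.points 0 + ∑ i, (t : Fin d → ℝ) i • (frame S i : E n), param_mem S t⟩

/-- The integral of a `d`-form over a `d`-simplex with orientation `o`: the integral over the
reference simplex of the pullback of the form by the affine parametrization, with the sign `+1` or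
`-1` according as the parametrization preserves or reverses orientation.
(An orientation is a ray of nonzero elements of `Altᵈ`.) -/
def formIntegral {n d : ℕ} (S : Affine.Simplex ℝ (E n) d)
    (o : Orientation ℝ (tangent S) (Fin d)) (ω : DForm S.closedInterior (tangent S) d) : ℝ :=
  Real.sign (o.someVector (frame S)) *
    ∫ t : refSimplex d, ω (param S t) (frame S) ∂(Measure.comap Subtype.val volume)

/-- A face of dimension `d = k + l ≥ k` of an `n`-simplex, given by its `d + 1` vertices. -/
structure Face (n k : ℕ) where
  /-- The difference `d - k`. -/
  l : ℕ
  /-- The indices of the vertices of the face. -/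
  verts : Finset (Fin (n + 1))
  card_verts : verts.card = (k + l) + 1

/-- The dimension of a face. -/
abbrev Face.dim {n k : ℕ} (f : Face n k) : ℕ := k + f.l

/-- The face as a simplex. -/
abbrev Face.simplex {n k : ℕ} (f : Face n k) (T : Affine.Simplex ℝ (E n) n) :
    Affine.Simplex ℝ (E n) f.dim :=
  T.face f.card_verts

theorem Face.subset {n k : ℕ} (f : Face n k) (T : Affine.Simplex ℝ (E n) n) :
    (f.simplex T).closedInterior ⊆ T.closedInterior := by
  rw [← Affine.Simplex.convexHull_eq_closedInterior, ← Affine.Simplex.convexHull_eq_closedInterior,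
    Affine.Simplex.range_face_points]
  exact convexHull_mono (Set.image_subset_range _ _)

/-- The test space `𝒫_{r+k-d-1} Λ^{d-k}(f)` of a face `f` of dimension `d`. -/
abbrev testForms {n k : ℕ} (T : Affine.Simplex ℝ (E n) n) (r : ℕ) (f : Face n k) :
    Submodule ℝ (DForm (f.simplex T).closedInterior (tangent (f.simplex T)) f.l) :=
  polyForms (f.simplex T).closedInterior (tangent (f.simplex T))
    ((r : ℤ) + k - f.dim - 1) f.l

/-- The number `∫_f tr_f u ∧ q`, where `f` carries the orientation `o`. -/
def dof {n k : ℕ} (T : Affine.Simplex ℝ (E n) n) (f : Face n k)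
    (o : Orientation ℝ (tangent (f.simplex T)) (Fin f.dim))
    (q : DForm (f.simplex T).closedInterior (tangent (f.simplex T)) f.l)
    (u : DForm T.closedInterior (E n) k) : ℝ :=
  formIntegral (f.simplex T) o
    (fun x => wedge (trace (f.subset T) (tangent (f.simplex T)) u x) (q x))

end FEForms

end

/-! Write λ_i for the barycentric coordinates of `T` and φ_v for the Whitney form of a tuple v of
vertices. It suffices that the functionals induce a bijection from the product of the test spaces
over all faces onto the dual of `𝒫_r⁻ Λᵏ(T)`, since bases of the factors then give a basis of the
dual. No dimension formula is needed: both halves rest on the explicit extension operators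
`faceExt`. The one for f sends a test form on f into `𝒫_r⁻ Λᵏ(T)` (`faceExt_mem`) and takes λ^β
dλ_τ, up to a constant, to λ^β λ_τ φ_{f∖τ}, where τ avoids the first vertex of f.

Injectivity (`totalDof_injective`). The extension of q from f has zero trace on every face not
containing f (`trace_faceExt_eq_zero`), and on f its wedge product with q is bounded below by a
weighted sum of squares of the coefficients of q (`sum_sq_le_wedge_trace_faceExt`). So the pairing
is block triangular for inclusion of faces, with definite diagonal blocks. The lower bound is pure
algebra: by ∑ dλ_i = 0 the cross terms of the Whitney forms regroup into further squares
(`sum_zeroCons_mul_sum_eq`).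

Dimension bound (`finrank_polyMinusForms_le`). `𝒫_r⁻ Λᵏ(T)` is spanned by the products λ^β φ_v with
|β| = r - 1. The relation ∑ (-1)^j λ_{ρ_j} φ_{ρ∖ρ_j} = 0 allows φ_v to contain the least vertex that
occurs in the product, and such a product is a nonzero multiple of an extension from the face of all
vertices that occur. Hence the extensions span, and the dimension is at most that of the product of
the test spaces. An injective map to the dual is then bijective. -/

noncomputable section

namespace FEForms

/-! ### Exterior products of linear forms and the wedge product. -/

section Algebra

variable {W : Type*} [AddCommGroup W] [Module ℝ W]

/-- Evaluation of alternating maps at given vectors. -/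
def altEval {V : Type*} [AddCommGroup V] [Module ℝ V] {k : ℕ} (w : Fin k → W) :
    (W [⋀^Fin k]→ₗ[ℝ] V) →ₗ[ℝ] V where
  toFun α := α w
  map_add' _ _ := rfl
  map_smul' _ _ := rfl

theorem altEval_apply {V : Type*} [AddCommGroup V] [Module ℝ V] {k : ℕ} (w : Fin k → W)
    (α : W [⋀^Fin k]→ₗ[ℝ] V) : altEval w α = α w := rfl

theorem alternatingMap_sum_apply {V : Type*} [AddCommGroup V] [Module ℝ V] {k : ℕ} {ι : Type*}
    (s : Finset ι) (α : ι → W [⋀^Fin k]→ₗ[ℝ] V) (w : Fin k → W) :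
    (∑ i ∈ s, α i) w = ∑ i ∈ s, α i w :=
  map_sum (altEval w) α s

theorem sum_map_cons {V : Type*} [AddCommGroup V] [Module ℝ V] {k : ℕ} {ι : Type*}
    (s : Finset ι) (α : W [⋀^Fin (k + 1)]→ₗ[ℝ] V) (a : ι → W) (w : Fin k → W) :
    ∑ i ∈ s, α (Fin.cons (a i) w) = α (Fin.cons (∑ i ∈ s, a i) w) :=
  (map_sum (altEval w ∘ₗ α.curryLeft) a s).symm

theorem map_comp_perm {V : Type*} [AddCommGroup V] [Module ℝ V] {k : ℕ} (α : W [⋀^Fin k]→ₗ[ℝ] V)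
    (w : Fin k → W) (π : Equiv.Perm (Fin k)) :
    α (w ∘ π) = ((Equiv.Perm.sign π : ℤ) : ℝ) • α w := by
  rw [α.map_perm, Units.smul_def, Int.cast_smul_eq_zsmul]

theorem sign_mul_sign {k : ℕ} (π : Equiv.Perm (Fin k)) :
    ((Equiv.Perm.sign π : ℤ) : ℝ) * ((Equiv.Perm.sign π : ℤ) : ℝ) = 1 := by
  rw [← Int.cast_mul, ← Units.val_mul]
  simp

theorem detRowAlternating_update {k : ℕ} (ℓ : Fin k → W →ₗ[ℝ] ℝ) (j : Fin k) (w : Fin k → W)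
    (c : W →ₗ[ℝ] ℝ) :
    Matrix.detRowAlternating.compLinearMap (LinearMap.pi (Function.update ℓ j c)) w =
      ((Matrix.of fun (i j : Fin k) => ℓ j (w i)).updateCol j (fun i => (c (w i) : ℝ))).det := by
  refine congrArg Matrix.det (Matrix.ext fun i j' => ?_)
  rcases eq_or_ne j' j with rfl | hj <;> simp [*]

/-- The exterior product `ℓ₁ ∧ … ∧ ℓₖ` of linear forms, as an alternating function of the
linear forms. -/
def detForm (W : Type*) [AddCommGroup W] [Module ℝ W] (k : ℕ) :
    (W →ₗ[ℝ] ℝ) [⋀^Fin k]→ₗ[ℝ] (W [⋀^Fin k]→ₗ[ℝ] ℝ) where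
  toFun ℓ := Matrix.detRowAlternating.compLinearMap (LinearMap.pi ℓ)
  map_update_add' ℓ j a b := by
    rename_i inst
    obtain rfl := Subsingleton.elim (instDecidableEqFin k) inst
    ext w
    have h := detRowAlternating_update ℓ j w
    rw [AlternatingMap.add_apply, h, h, h, ← Matrix.det_updateCol_add]
    rfl
  map_update_smul' ℓ j a b := by
    rename_i inst
    obtain rfl := Subsingleton.elim (instDecidableEqFin k) inst
    ext w
    have h := detRowAlternating_update ℓ j w
    rw [AlternatingMap.smul_apply, h, h, smul_eq_mul, ← Matrix.det_updateCol_smul]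
    rfl
  map_eq_zero_of_eq' ℓ i j h hij := by
    ext w
    exact Matrix.det_zero_of_column_eq hij fun m => by
      simp [LinearMap.pi_apply, h]

theorem detForm_apply {k : ℕ} (ℓ : Fin k → W →ₗ[ℝ] ℝ) (w : Fin k → W) :
    detForm W k ℓ w = (Matrix.of fun i j => ℓ j (w i)).det := rfl

theorem detForm_compLinearMap {W' : Type*} [AddCommGroup W'] [Module ℝ W'] {k : ℕ}
    (ℓ : Fin k → W →ₗ[ℝ] ℝ) (g : W' →ₗ[ℝ] W) :
    (detForm W k ℓ).compLinearMap g = detForm W' k (fun j => ℓ j ∘ₗ g) := rfl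

/-- The wedge product as a bilinear map. -/
def wedgeₗ (W : Type*) [AddCommGroup W] [Module ℝ W] (k l : ℕ) :
    (W [⋀^Fin k]→ₗ[ℝ] ℝ) →ₗ[ℝ] (W [⋀^Fin l]→ₗ[ℝ] ℝ) →ₗ[ℝ] W [⋀^Fin (k + l)]→ₗ[ℝ] ℝ :=
  LinearMap.mk₂ ℝ wedge
    (fun a b c => by
      simp only [wedge, ← AlternatingMap.domCoprod'_apply, TensorProduct.add_tmul, map_add]
      ext; simp)
    (fun a b c => by
      simp only [wedge, ← AlternatingMap.domCoprod'_apply, ← TensorProduct.smul_tmul', map_smul]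
      ext; simp)
    (fun a b c => by
      simp only [wedge, ← AlternatingMap.domCoprod'_apply, TensorProduct.tmul_add, map_add]
      ext; simp)
    (fun a b c => by
      simp only [wedge, ← AlternatingMap.domCoprod'_apply, TensorProduct.tmul_smul, map_smul]
      ext; simp)

theorem wedgeₗ_apply {k l : ℕ} (a : W [⋀^Fin k]→ₗ[ℝ] ℝ) (b : W [⋀^Fin l]→ₗ[ℝ] ℝ) :
    wedgeₗ W k l a b = wedge a b := rfl

theorem wedge_add {k l : ℕ} (a : W [⋀^Fin k]→ₗ[ℝ] ℝ) (b c : W [⋀^Fin l]→ₗ[ℝ] ℝ) :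
    wedge a (b + c) = wedge a b + wedge a c := map_add (wedgeₗ W k l a) b c

theorem wedge_smul {k l : ℕ} (r : ℝ) (a : W [⋀^Fin k]→ₗ[ℝ] ℝ) (b : W [⋀^Fin l]→ₗ[ℝ] ℝ) :
    wedge a (r • b) = r • wedge a b := map_smul (wedgeₗ W k l a) r b

theorem add_wedge {k l : ℕ} (a b : W [⋀^Fin k]→ₗ[ℝ] ℝ) (c : W [⋀^Fin l]→ₗ[ℝ] ℝ) :
    wedge (a + b) c = wedge a c + wedge b c := LinearMap.map_add₂ (wedgeₗ W k l) a b c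

theorem smul_wedge {k l : ℕ} (r : ℝ) (a : W [⋀^Fin k]→ₗ[ℝ] ℝ) (b : W [⋀^Fin l]→ₗ[ℝ] ℝ) :
    wedge (r • a) b = r • wedge a b := LinearMap.map_smul₂ (wedgeₗ W k l) r a b

theorem wedge_apply {k l : ℕ} (a : W [⋀^Fin k]→ₗ[ℝ] ℝ) (b : W [⋀^Fin l]→ₗ[ℝ] ℝ)
    (w : Fin (k + l) → W) :
    wedge a b w = ∑ σ : Equiv.Perm.ModSumCongr (Fin k) (Fin l),
      LinearMap.mul' ℝ ℝ (AlternatingMap.domCoprod.summand a b σ (w ∘ finSumFinEquiv)) := by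
  rw [wedge, AlternatingMap.domDomCongr_apply, LinearMap.compAlternatingMap_apply,
    AlternatingMap.domCoprod_apply, _root_.sum_apply, map_sum]

/-- A product `ℓ₁ ∧ … ∧ ℓₖ ∧ β` on vectors such that `ℓᵢ (wⱼ) = δᵢⱼ` for all `i ≤ k`. -/
theorem wedge_detForm_apply_of_dual {k l : ℕ} (ℓ : Fin k → W →ₗ[ℝ] ℝ)
    (β : W [⋀^Fin l]→ₗ[ℝ] ℝ) (w : Fin (k + l) → W)
    (h1 : ∀ i j, ℓ i (w (Fin.castAdd l j)) = if i = j then 1 else 0)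
    (h2 : ∀ i j, ℓ i (w (Fin.natAdd k j)) = 0) :
    wedge (detForm W k ℓ) β w = β (w ∘ Fin.natAdd k) := by
  rw [wedge_apply]
  -- Only the trivial shuffle contributes: any other one feeds one of the last `l` vectors to the
  -- first factor, whose determinant then has a zero row.
  refine (Finset.sum_eq_single
    (Quotient.mk'' 1 : Equiv.Perm.ModSumCongr (Fin k) (Fin l)) ?_ ?_).trans ?_
  rotate_right
  · rw [AlternatingMap.domCoprod.summand_mk'']
    have : (detForm W k ℓ) (w ∘ Fin.castAdd l) = 1 := by
      rw [detForm_apply]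
      convert Matrix.det_one (n := Fin k) (R := ℝ) using 2
      ext i j
      simp [h1, Matrix.one_apply, eq_comm]
    simp only [Equiv.Perm.sign_one, one_smul, MultilinearMap.domDomCongr_apply,
      MultilinearMap.domCoprod_apply, LinearMap.mul'_apply, AlternatingMap.coe_multilinearMap]
    convert one_mul _ using 2
    · exact this
    · rfl
  · intro σ _
    induction σ using Quotient.inductionOn' with | _ σ
    intro hσ
    rw [AlternatingMap.domCoprod.summand_mk'']
    have hn : ¬ Set.MapsTo σ (Set.range (Sum.inl : Fin k → Fin k ⊕ Fin l)) (Set.range Sum.inl) := by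
      intro hm
      apply hσ
      apply Quotient.sound'
      rw [QuotientGroup.leftRel_apply]
      have := Equiv.Perm.mem_sumCongrHom_range_of_perm_mapsTo_inl hm
      simpa using this
    simp only [Set.MapsTo, Set.mem_range, forall_exists_index, forall_apply_eq_imp_iff,
      not_forall] at hn
    obtain ⟨i, hi⟩ := hn
    have h0 : (detForm W k ℓ) (fun j => (w ∘ finSumFinEquiv) (σ (Sum.inl j))) = 0 := by
      rw [detForm_apply]
      apply Matrix.det_eq_zero_of_row_eq_zero i
      intro j
      rcases hs : σ (Sum.inl i) with m | m
      · exact absurd ⟨m, hs.symm⟩ hi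
      · simp [hs, h2]
    simp only [_root_.smul_apply, MultilinearMap.domDomCongr_apply,
      MultilinearMap.domCoprod_apply, AlternatingMap.coe_multilinearMap]
    rw [h0]
    simp
  · simp

/-- Reordering the dual vectors by `π` reduces to the standard order of the previous lemma, and the
wedge product changes by the sign of `π`. -/
theorem wedge_detForm_apply_of_perm {k l : ℕ} (ℓ : Fin (k + l) → W →ₗ[ℝ] ℝ)
    (β : W [⋀^Fin l]→ₗ[ℝ] ℝ) (w : Fin (k + l) → W)
    (h : ∀ i j, ℓ i (w j) = if i = j then 1 else 0) (π : Equiv.Perm (Fin (k + l))) :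
    wedge (detForm W k (ℓ ∘ π ∘ Fin.castAdd l)) β w =
      (Equiv.Perm.sign π : ℤ) * β (w ∘ π ∘ Fin.natAdd k) := by
  have h1 := wedge_detForm_apply_of_dual (ℓ ∘ π ∘ Fin.castAdd l) β (w ∘ π)
    (by intro i j; simp [h]) (by
      intro i j
      simp only [Function.comp_apply, h, EmbeddingLike.apply_eq_iff_eq]
      rw [if_neg]
      intro h; have := congrArg Fin.val h; simp at this; omega)
  rw [map_comp_perm, smul_eq_mul] at h1
  have h2 : w ∘ π ∘ Fin.natAdd k = (w ∘ π) ∘ Fin.natAdd k := rfl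
  rw [h2, ← h1, ← mul_assoc, sign_mul_sign, one_mul]

/-- An injective tuple of length `k` in `Fin (k + l)` extends to a permutation. -/
theorem exists_perm_castAdd {k l : ℕ} {v : Fin k → Fin (k + l)} (hv : Function.Injective v) :
    ∃ π : Equiv.Perm (Fin (k + l)), π ∘ Fin.castAdd l = v := by
  obtain ⟨π, hπ⟩ := Equiv.Perm.exists_extending_pair (Fin.castAdd l) v
    (Fin.castAdd_injective k l) hv
  exact ⟨π, funext hπ⟩

/-- Alternating forms are spanned by the exterior products of the coordinates of a basis. -/
theorem span_detForm_coord {ι : Type*} [Fintype ι] [DecidableEq ι] (b : Module.Basis ι ℝ W)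
    (k : ℕ) :
    Submodule.span ℝ (Set.range fun v : Fin k → ι => detForm W k (fun j => b.coord (v j))) = ⊤ := by
  rw [eq_top_iff]
  intro α _
  -- The sum runs over all tuples instead of increasing ones, which counts every exterior monomial
  -- `k!` times. On injective basis tuples `u` only the `k!` rearrangements of `u` contribute, each
  -- with the same value.
  have key : (k.factorial : ℝ) • α =
      ∑ v : Fin k → ι, α (b ∘ v) • detForm W k (fun j => b.coord (v j)) := by
    refine b.ext_alternating fun u hu => ?_
    rw [AlternatingMap.smul_apply, smul_eq_mul, alternatingMap_sum_apply]
    simp only [AlternatingMap.smul_apply, smul_eq_mul]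
    rw [← Fintype.sum_of_injective (fun π : Equiv.Perm (Fin k) => u ∘ π)
      (fun π π' h => Equiv.ext fun i => hu (congrFun h i)) (fun _ => α (fun i => b (u i)))]
    · simp [Fintype.card_perm]
    · intro v hv
      rw [detForm_apply, mul_eq_zero_of_right]
      by_contra hdet
      have hcol : ∀ j, ∃ i, u i = v j := by
        intro j
        by_contra! hj
        exact hdet (Matrix.det_eq_zero_of_column_eq_zero j fun i => by
          simp [Finsupp.single_apply, hj i])
      have hrow : ∀ i, ∃ j, u i = v j := by
        intro i
        by_contra! hi
        exact hdet (Matrix.det_eq_zero_of_row_eq_zero i fun j => by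
          simp [Finsupp.single_apply, hi j])
      choose g hg using hcol
      have hgs : Function.Surjective g := by
        intro i
        obtain ⟨j, hj⟩ := hrow i
        exact ⟨j, hu ((hg j).trans hj.symm)⟩
      exact hv ⟨Equiv.ofBijective g (Finite.surjective_iff_bijective.1 hgs), funext hg⟩
    · intro π
      have h1 : α (b ∘ u ∘ π) = (Equiv.Perm.sign π : ℤ) * α (fun i => b (u i)) :=
         map_comp_perm α (fun i => b (u i)) π
      have h2 : detForm W k (fun j => b.coord ((u ∘ π) j)) (fun i => b (u i)) =
          (Equiv.Perm.sign π : ℤ) := by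
        refine (congrArg (altEval fun i => b (u i))
          (map_comp_perm (detForm W k) (fun j => b.coord (u j)) π)).trans ?_
        rw [map_smul, smul_eq_mul, altEval_apply, detForm_apply]
        convert mul_one _
        convert Matrix.det_one (n := Fin k) (R := ℝ) using 2
        ext i j
        simp [Finsupp.single_apply, Matrix.one_apply, hu.eq_iff]
      rw [h1, h2, mul_right_comm, sign_mul_sign, one_mul]
  have hk : (k.factorial : ℝ) ≠ 0 := by positivity
  rw [← inv_smul_smul₀ hk α, key]
  exact Submodule.smul_mem _ _ (Submodule.sum_mem _ fun v _ =>
    Submodule.smul_mem _ _ (Submodule.subset_span ⟨v, rfl⟩))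

end Algebra

/-! ### The algebraic positivity behind the definiteness of the pairing. -/

section Positivity

variable {V : Type*} [AddCommGroup V] [Module ℝ V] {d : ℕ}

/-- The product of the `lam i` over the indices `i` that are not entries of `v`. -/
def offProd {m : ℕ} (lam : Fin (d + 1) → ℝ) (v : Fin m → Fin (d + 1)) : ℝ :=
  ∏ i ∈ (Finset.univ.image v)ᶜ, lam i

theorem offProd_nonneg {m : ℕ} {lam : Fin (d + 1) → ℝ} (h : ∀ i, 0 ≤ lam i)
    (v : Fin m → Fin (d + 1)) : 0 ≤ offProd lam v :=
  Finset.prod_nonneg fun i _ => h i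

theorem offProd_pos {m : ℕ} {lam : Fin (d + 1) → ℝ} (h : ∀ i, 0 < lam i)
    (v : Fin m → Fin (d + 1)) : 0 < offProd lam v :=
  Finset.prod_pos fun i _ => h i

theorem offProd_mul_of_image_eq_insert {m m' : ℕ} (lam : Fin (d + 1) → ℝ)
    {v : Fin m → Fin (d + 1)} {u : Fin m' → Fin (d + 1)} {i : Fin (d + 1)}
    (h : Finset.univ.image v = insert i (Finset.univ.image u)) (hi : i ∉ Finset.univ.image u) :
    offProd lam v * lam i = offProd lam u := by
  have : (Finset.univ.image u)ᶜ = insert i (Finset.univ.image v)ᶜ := by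
    ext a
    by_cases ha : a = i
    · subst ha; simpa using hi
    · have := Finset.ext_iff.1 h a
      simp only [Finset.mem_insert, ha, false_or] at this
      simp [Finset.mem_compl, Finset.mem_insert, ha, this]
  rw [offProd, offProd, this, Finset.prod_insert, mul_comm]
  simp [h]

/-- The vertices `0, v₁ + 1, …, vₖ + 1`. -/
def zeroCons {k : ℕ} (v : Fin k → Fin d) : Fin (k + 1) → Fin (d + 1) :=
  Fin.cons 0 (Fin.succ ∘ v)

theorem image_zeroCons {k : ℕ} (v : Fin k → Fin d) :
    Finset.univ.image (zeroCons v) = insert 0 (Finset.univ.image (Fin.succ ∘ v)) := by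
  ext a
  simp [zeroCons, Fin.exists_fin_succ, eq_comm]

theorem zeroCons_insertNth_comp_succAbove {k : ℕ} (j : Fin (k + 1)) (i : Fin d)
    (z : Fin k → Fin d) :
    zeroCons (Fin.insertNth j i z : Fin (k + 1) → Fin d) ∘ j.succ.succAbove = zeroCons z := by
  ext a
  refine Fin.cases ?_ (fun a => ?_) a <;> simp [zeroCons]

/-- Write `v` as `z` with `i` inserted at position `j`. The factor `lam i.succ` completes the
product over the complement of `(0, v)` to the one over the complement of `(0, z)`, so the weight
depends on `z` only. Moving `ℓ i.succ` to the front costs `(-1) ^ j`, and summing over `i` gives `-c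
(ℓ ∘ zeroCons z)` because the `ℓ i` add up to zero. The two minus signs cancel and leave a square,
once for each of the `k + 1` positions. -/
theorem sum_zeroCons_mul_sum_eq {k : ℕ} (lam : Fin (d + 1) → ℝ) (ℓ : Fin (d + 1) → V)
    (hℓ : ∑ i, ℓ i = 0) (c : V [⋀^Fin (k + 1)]→ₗ[ℝ] ℝ) :
    ∑ v : Fin (k + 1) → Fin d, offProd lam (zeroCons v) * c (ℓ ∘ Fin.succ ∘ v) *
        ∑ j : Fin (k + 1), (-1) ^ (j.succ : ℕ) * lam (zeroCons v j.succ) *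
          c (ℓ ∘ zeroCons v ∘ j.succ.succAbove) =
      (k + 1) * ∑ z : Fin k → Fin d, offProd lam (zeroCons z) * c (ℓ ∘ zeroCons z) ^ 2 := by
  have key : ∀ (j : Fin (k + 1)) (i : Fin d) (z : Fin k → Fin d),
      offProd lam (zeroCons (Fin.insertNth j i z : Fin (k + 1) → Fin d)) *
        c (ℓ ∘ Fin.succ ∘ (Fin.insertNth j i z : Fin (k + 1) → Fin d)) *
        ((-1) ^ (j.succ : ℕ) *
          lam (zeroCons (Fin.insertNth j i z : Fin (k + 1) → Fin d) j.succ) *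
          c (ℓ ∘ zeroCons (Fin.insertNth j i z : Fin (k + 1) → Fin d) ∘ j.succ.succAbove)) =
      - (offProd lam (zeroCons z) * c (ℓ ∘ zeroCons z)) *
        c (Matrix.vecCons (ℓ i.succ) (ℓ ∘ Fin.succ ∘ z)) := by
    intro j i z
    have h1 : ℓ ∘ Fin.succ ∘ (Fin.insertNth j i z : Fin (k + 1) → Fin d) =
        (j.insertNth (ℓ i.succ) (ℓ ∘ Fin.succ ∘ z) : Fin (k + 1) → V) := by
      rw [Fin.eq_insertNth_iff]
      refine ⟨by simp, ?_⟩
      ext a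
      simp [Fin.removeNth]
    have h2 : c (ℓ ∘ Fin.succ ∘ (Fin.insertNth j i z : Fin (k + 1) → Fin d)) =
        (-1) ^ (j : ℕ) * c (Matrix.vecCons (ℓ i.succ) (ℓ ∘ Fin.succ ∘ z)) := by
      rw [h1, AlternatingMap.map_insertNth]
      simp
    have h3 : zeroCons (Fin.insertNth j i z : Fin (k + 1) → Fin d) j.succ = i.succ := by
      simp [zeroCons]
    have h4 : ((-1 : ℝ) ^ (j : ℕ)) * (-1) ^ (j : ℕ) = 1 := by
      rw [← mul_pow]; simp
    rw [zeroCons_insertNth_comp_succAbove, h2, h3, Fin.val_succ, pow_succ]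
    -- For `i` already among the entries of `z` the identity of weights fails, but both sides vanish
    -- by alternation.
    by_cases hi : i ∈ Finset.univ.image z
    · have : c (Matrix.vecCons (ℓ i.succ) (ℓ ∘ Fin.succ ∘ z)) = 0 := by
        obtain ⟨a, -, rfl⟩ := Finset.mem_image.1 hi
        exact c.map_eq_zero_of_eq (i := 0) (j := a.succ) _ (by simp) (Fin.succ_ne_zero _).symm
      simp [this]
    · have h5 : offProd lam (zeroCons (Fin.insertNth j i z : Fin (k + 1) → Fin d)) * lam i.succ =
          offProd lam (zeroCons z) := by
        apply offProd_mul_of_image_eq_insert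
        · ext a
          simp only [image_zeroCons, Finset.mem_insert, Finset.mem_image, Finset.mem_univ,
            true_and, Function.comp_apply]
          rw [Fin.exists_iff_succAbove j]
          simp only [Fin.insertNth_apply_same, Fin.insertNth_apply_succAbove]
          tauto
        · simpa [image_zeroCons, Fin.succ_ne_zero] using hi
      rw [← h5]
      linear_combination (-(offProd lam (zeroCons (Fin.insertNth j i z : Fin (k + 1) → Fin d))) *
        lam i.succ * c (ℓ ∘ zeroCons z) *
        c (Matrix.vecCons (ℓ i.succ) (ℓ ∘ Fin.succ ∘ z))) * h4
  have hsum : ∀ z : Fin k → Fin d,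
      ∑ i : Fin d, c (Matrix.vecCons (ℓ i.succ) (ℓ ∘ Fin.succ ∘ z)) = - c (ℓ ∘ zeroCons z) := by
    intro z
    have h0 : ℓ ∘ zeroCons z = Matrix.vecCons (ℓ 0) (ℓ ∘ Fin.succ ∘ z) := by
      ext a
      refine Fin.cases ?_ (fun a => ?_) a <;> simp [zeroCons]
    rw [h0, eq_neg_iff_add_eq_zero, add_comm]
    have h1 := sum_map_cons Finset.univ c ℓ (ℓ ∘ Fin.succ ∘ z)
    rw [hℓ, c.map_coord_zero (m := Fin.cons 0 _) 0 (by simp), Fin.sum_univ_succ] at h1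
    exact h1
  rw [Finset.sum_congr rfl fun v _ => Finset.mul_sum _ _ _, Finset.sum_comm]
  have hj : ∀ j : Fin (k + 1), ∑ v : Fin (k + 1) → Fin d,
      offProd lam (zeroCons v) * c (ℓ ∘ Fin.succ ∘ v) * ((-1) ^ (j.succ : ℕ) *
        lam (zeroCons v j.succ) * c (ℓ ∘ zeroCons v ∘ j.succ.succAbove)) =
      ∑ z : Fin k → Fin d, offProd lam (zeroCons z) * c (ℓ ∘ zeroCons z) ^ 2 := by
    intro j
    rw [← (Fin.insertNthEquiv (fun _ => Fin d) j).sum_comp, Fintype.sum_prod_type_right]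
    refine Finset.sum_congr rfl fun z _ => ?_
    refine (Finset.sum_congr rfl fun i _ => key j i z).trans ?_
    rw [← Finset.mul_sum, hsum]
    ring
  rw [Finset.sum_congr rfl fun j _ => hj j]
  simp [Finset.mul_sum]

/-- The term `j = 0` of the inner sum gives exactly the left side. The others add up to a sum of
squares with nonnegative weights, by the preceding identity. -/
theorem sum_sq_le_sum_zeroCons {k : ℕ} {lam : Fin (d + 1) → ℝ} (hlam : ∀ i, 0 ≤ lam i)
    (ℓ : Fin (d + 1) → V) (hℓ : ∑ i, ℓ i = 0) (c : V [⋀^Fin k]→ₗ[ℝ] ℝ) :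
    ∑ v : Fin k → Fin d, offProd lam (zeroCons v) * lam 0 * c (ℓ ∘ Fin.succ ∘ v) ^ 2 ≤
      ∑ v : Fin k → Fin d, offProd lam (zeroCons v) * c (ℓ ∘ Fin.succ ∘ v) *
        ∑ j : Fin (k + 1), (-1) ^ (j : ℕ) * lam (zeroCons v j) *
          c (ℓ ∘ zeroCons v ∘ j.succAbove) := by
  have h0 : ∀ v : Fin k → Fin d, zeroCons v ∘ (0 : Fin (k + 1)).succAbove = Fin.succ ∘ v := by
    intro v; ext a; simp [zeroCons]
  have h1 : ∀ v : Fin k → Fin d, zeroCons v 0 = 0 := fun v => by simp [zeroCons]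
  simp only [Fin.sum_univ_succ, mul_add, Finset.sum_add_distrib, h0, h1, Fin.val_zero, pow_zero,
    one_mul]
  have h2 : ∀ v : Fin k → Fin d, offProd lam (zeroCons v) * lam 0 * c (ℓ ∘ Fin.succ ∘ v) ^ 2 =
      offProd lam (zeroCons v) * c (ℓ ∘ Fin.succ ∘ v) * (lam 0 * c (ℓ ∘ Fin.succ ∘ v)) := by
    intro v; ring
  simp only [h2, le_add_iff_nonneg_right]
  cases k with
  | zero => simp
  | succ k =>
    rw [sum_zeroCons_mul_sum_eq lam ℓ hℓ c]
    exact mul_nonneg (by positivity) (Finset.sum_nonneg fun z _ =>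
      mul_nonneg (offProd_nonneg hlam _) (sq_nonneg _))

end Positivity

/-! ### Laplace expansion and dual bases. -/

section Laplace

variable {W : Type*} [AddCommGroup W] [Module ℝ W]

/-- Laplace expansion of `(ℓ₀ ∧ … ∧ ℓₖ)(w₀, …, wₖ)` along `w₀`. -/
theorem detForm_succ_apply {k : ℕ} (ℓ : Fin (k + 1) → W →ₗ[ℝ] ℝ) (w : Fin (k + 1) → W) :
    detForm W (k + 1) ℓ w = ∑ j : Fin (k + 1), (-1) ^ (j : ℕ) * ℓ j (w 0) *
      detForm W k (ℓ ∘ j.succAbove) (w ∘ Fin.succ) := by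
  rw [detForm_apply, Matrix.det_succ_row_zero]
  rfl

theorem exists_basis_of_dual {d : ℕ} (b : Fin d → W) (ℓ : Fin d → W →ₗ[ℝ] ℝ)
    (h : ∀ i j, ℓ i (b j) = if i = j then 1 else 0) (hd : Module.finrank ℝ W = d)
    [FiniteDimensional ℝ W] :
    ∃ B : Module.Basis (Fin d) ℝ W, (∀ i, B i = b i) ∧ ∀ i, B.coord i = ℓ i := by
  have hli : LinearIndependent ℝ b := by
    rw [Fintype.linearIndependent_iff]
    intro g hg i
    have := congrArg (ℓ i) hg
    simpa [h] using this
  rcases Nat.eq_zero_or_pos d with rfl | hpos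
  · have : Subsingleton W := Module.finrank_zero_iff.1 hd
    exact ⟨Module.Basis.empty W, fun i => i.elim0, fun i => i.elim0⟩
  · have : Nonempty (Fin d) := ⟨⟨0, hpos⟩⟩
    let B := basisOfLinearIndependentOfCardEqFinrank hli (by simp [hd])
    have hB : ∀ i, B i = b i := fun i => by simp [B]
    refine ⟨B, hB, fun i => B.ext fun j => ?_⟩
    rw [hB j, h, ← hB j]
    simp [Finsupp.single_apply, eq_comm]

end Laplace

/-! ### Barycentric coordinates and Whitney forms. -/

section Barycentric

variable {n : ℕ} (T : Affine.Simplex ℝ (E n) n)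

/-- The vertices of a full-dimensional simplex as an affine basis. -/
def vertexBasis : AffineBasis (Fin (n + 1)) ℝ (E n) :=
  ⟨T.points, T.independent, T.independent.affineSpan_eq_top_iff_card_eq_finrank_add_one.2 (by simp)⟩

/-- The barycentric coordinates of a full-dimensional simplex. -/
def bary (i : Fin (n + 1)) : E n →ᵃ[ℝ] ℝ := (vertexBasis T).coord i

/-- The differentials of the barycentric coordinates. -/
def dbary (i : Fin (n + 1)) : E n →ₗ[ℝ] ℝ := (bary T i).linear

theorem bary_points (i j : Fin (n + 1)) : bary T i (T.points j) = if i = j then 1 else 0 :=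
  (vertexBasis T).coord_apply i j

theorem sum_bary (x : E n) : ∑ i, bary T i x = 1 := (vertexBasis T).sum_coord_apply_eq_one x

theorem sum_bary_smul (x : E n) : ∑ i, bary T i x • T.points i = x :=
  (vertexBasis T).linear_combination_coord_eq_self x

theorem bary_eq (i : Fin (n + 1)) (x : E n) : bary T i x = bary T i 0 + dbary T i x := by
  have := (bary T i).map_vadd 0 x
  simpa [dbary, add_comm] using this

theorem dbary_sub (i : Fin (n + 1)) (x y : E n) :
    dbary T i (x - y) = bary T i x - bary T i y := by
  rw [map_sub, bary_eq T i x, bary_eq T i y]; ring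

theorem dbary_points_sub (i j m : Fin (n + 1)) : dbary T i (T.points j - T.points m) =
    (if i = j then 1 else 0) - if i = m then 1 else 0 := by
  rw [dbary_sub, bary_points, bary_points]

theorem sum_dbary : ∑ i, dbary T i = 0 := by
  ext x
  have h1 := sum_bary T x
  have h0 := sum_bary T 0
  simp only [bary_eq T _ x, Finset.sum_add_distrib] at h1
  simp only [LinearMap.sum_apply, LinearMap.zero_apply]
  linarith

theorem bary_nonneg {x : E n} (hx : x ∈ T.closedInterior) (i : Fin (n + 1)) : 0 ≤ bary T i x := by
  rw [← Affine.Simplex.convexHull_eq_closedInterior] at hx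
  have : convexHull ℝ (Set.range T.points) ⊆ (bary T i) ⁻¹' Set.Ici 0 := by
    refine convexHull_min ?_ ((convex_Ici 0).affine_preimage _)
    rintro _ ⟨j, rfl⟩
    simp only [Set.mem_preimage, bary_points, Set.mem_Ici]
    split_ifs <;> norm_num
  exact this hx

theorem exists_basis_coord_eq_dbary :
    ∃ B : Module.Basis (Fin n) ℝ (E n), ∀ i, B.coord i = dbary T i.succ := by
  obtain ⟨B, -, hB⟩ := exists_basis_of_dual (fun j : Fin n => T.points j.succ - T.points 0)
    (fun i => dbary T i.succ) (fun i j => by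
      rw [dbary_points_sub]; simp [Fin.succ_ne_zero]) (by simp)
  exact ⟨B, hB⟩

theorem span_detForm_dbary (k : ℕ) :
    Submodule.span ℝ (Set.range fun v : Fin k → Fin (n + 1) => detForm (E n) k (dbary T ∘ v)) =
      ⊤ := by
  obtain ⟨B, hB⟩ := exists_basis_coord_eq_dbary T
  rw [eq_top_iff, ← span_detForm_coord B k]
  refine Submodule.span_mono ?_
  rintro _ ⟨v, rfl⟩
  refine ⟨Fin.succ ∘ v, ?_⟩
  simp only [hB]
  rfl

/-- The homogeneous barycentric coordinates, as linear forms on `ℝ × ℝⁿ`. -/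
def hbary (i : Fin (n + 1)) : ℝ × E n →ₗ[ℝ] ℝ :=
  (LinearMap.toSpanSingleton ℝ ℝ (bary T i 0)).coprod (dbary T i)

theorem hbary_apply (i : Fin (n + 1)) (t : ℝ) (x : E n) :
    hbary T i (t, x) = t * bary T i 0 + dbary T i x := by
  simp [hbary]

theorem hbary_one (i : Fin (n + 1)) (x : E n) : hbary T i (1, x) = bary T i x := by
  rw [hbary_apply, bary_eq T i x, one_mul]

theorem hbary_comp_inr (i : Fin (n + 1)) :
    hbary T i ∘ₗ LinearMap.inr ℝ ℝ (E n) = dbary T i := by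
  ext x; simp [hbary]

/-- The constant parts add up to one and the differentials to zero. Homogenizing makes a Whitney
form the contraction of a single exterior product with `(1, x)`, so that its identities become
multilinear algebra on `ℝ × E n`. -/
theorem sum_hbary : ∑ i, hbary T i = LinearMap.fst ℝ ℝ (E n) := by
  ext x
  · simp [hbary_apply, sum_bary]
  · have := LinearMap.congr_fun (sum_dbary T) x
    simpa [hbary_apply] using this

/-- The value at `x` of the Whitney form `∑ⱼ (-1)ʲ λ_{vⱼ} dλ_{v₀} ∧ …^… ∧ dλ_{vₖ}`. -/
def whitney {k : ℕ} (v : Fin (k + 1) → Fin (n + 1)) (x : E n) : E n [⋀^Fin k]→ₗ[ℝ] ℝ :=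
  ((detForm (ℝ × E n) (k + 1) (hbary T ∘ v)).curryLeft (1, x)).compLinearMap
    (LinearMap.inr ℝ ℝ (E n))

theorem detForm_hbary_apply {k : ℕ} (v : Fin k → Fin (n + 1)) (w : Fin k → E n) :
    detForm (ℝ × E n) k (hbary T ∘ v) (fun j => LinearMap.inr ℝ ℝ (E n) (w j)) =
      detForm (E n) k (dbary T ∘ v) w := by
  have : dbary T ∘ v = fun j => (hbary T ∘ v) j ∘ₗ LinearMap.inr ℝ ℝ (E n) := by
    funext j; exact (hbary_comp_inr T _).symm
  rw [this, ← detForm_compLinearMap]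
  rfl

theorem whitney_eq_sum {k : ℕ} (v : Fin (k + 1) → Fin (n + 1)) (x : E n) :
    whitney T v x = ∑ j : Fin (k + 1), ((-1) ^ (j : ℕ) * bary T (v j) x) •
      detForm (E n) k (dbary T ∘ v ∘ j.succAbove) := by
  ext w
  rw [alternatingMap_sum_apply]
  refine (detForm_succ_apply _ _).trans (Finset.sum_congr rfl fun j _ => ?_)
  rw [AlternatingMap.smul_apply, smul_eq_mul]
  rw [← detForm_hbary_apply T (v ∘ j.succAbove) w, ← hbary_one]
  rfl

/-- Contraction is linear, and `(1, x) = (1, 0) + (0, x)`. The second part is the Koszul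
differential of a constant form, which is what places Whitney forms in `𝒫₁⁻ Λᵏ`. -/
theorem whitney_eq_add {k : ℕ} (v : Fin (k + 1) → Fin (n + 1)) (x : E n) :
    whitney T v x = whitney T v 0 + (detForm (E n) (k + 1) (dbary T ∘ v)).curryLeft x := by
  have h : ((1 : ℝ), x) = (1, 0) + (0, x) := by simp
  rw [whitney, h, map_add, AlternatingMap.add_compLinearMap]
  congr 1
  ext w
  rw [AlternatingMap.curryLeft_apply_apply, ← detForm_hbary_apply]
  rw [AlternatingMap.compLinearMap_apply, AlternatingMap.curryLeft_apply_apply]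
  congr 1
  funext j
  refine Fin.cases ?_ (fun j => ?_) j <;> simp

theorem whitney_comp_perm {k : ℕ} (v : Fin (k + 1) → Fin (n + 1)) (π : Equiv.Perm (Fin (k + 1)))
    (x : E n) : whitney T (v ∘ π) x = ((Equiv.Perm.sign π : ℤ) : ℝ) • whitney T v x := by
  rw [whitney, whitney, ← Function.comp_assoc, map_comp_perm]
  rfl

theorem whitney_eq_zero_of_not_injective {k : ℕ} {v : Fin (k + 1) → Fin (n + 1)}
    (hv : ¬ Function.Injective v) (x : E n) : whitney T v x = 0 := by
  rw [whitney, AlternatingMap.map_eq_zero_of_not_injective]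
  · rfl
  · exact fun h => hv h.of_comp

/-- By linearity in the first form, the sum is the contraction of `dt ∧ dλ_v` with `(1, x)`, where
`dt` is the first projection of `ℝ × E n`. Since `dt` is 1 on `(1, x)` and 0 on the remaining
vectors, only the first Laplace term survives. -/
theorem sum_whitney_cons {k : ℕ} (v : Fin k → Fin (n + 1)) (x : E n) :
    ∑ i, whitney T (Fin.cons i v : Fin (k + 1) → Fin (n + 1)) x =
      detForm (E n) k (dbary T ∘ v) := by
  ext w
  rw [alternatingMap_sum_apply]
  have h : ∀ i, whitney T (Fin.cons i v : Fin (k + 1) → Fin (n + 1)) x w =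
      detForm (ℝ × E n) (k + 1) (Fin.cons (hbary T i) (hbary T ∘ v))
        (Fin.cons (1, x) fun j => LinearMap.inr ℝ ℝ (E n) (w j)) := by
    intro i
    rw [← Fin.comp_cons]
    rfl
  have h2 := congrArg (altEval (Fin.cons (1, x) fun j => LinearMap.inr ℝ ℝ (E n) (w j)))
    (sum_map_cons Finset.univ (detForm (ℝ × E n) (k + 1)) (hbary T) (hbary T ∘ v))
  rw [map_sum, sum_hbary] at h2
  simp only [h]
  refine h2.trans ?_
  rw [altEval_apply, detForm_succ_apply, Fin.sum_univ_succ, Finset.sum_eq_zero]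
  · rw [← detForm_hbary_apply]
    simp
  · intro j _
    have h0 : j.succ.succAbove ⟨0, j.pos⟩ = 0 := by
      rw [Fin.succAbove_of_castSucc_lt] <;> simp [Fin.lt_def]
    rw [detForm_apply, Matrix.det_eq_zero_of_column_eq_zero ⟨0, j.pos⟩, mul_zero]
    intro i
    simp [h0]

/-- The linear relation between the Whitney forms of the facets of a simplex. -/
theorem sum_bary_smul_whitney {k : ℕ} (ρ : Fin (k + 2) → Fin (n + 1)) (x : E n) :
    ∑ j : Fin (k + 2), ((-1) ^ (j : ℕ) * bary T (ρ j) x) • whitney T (ρ ∘ j.succAbove) x = 0 := by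
  ext w
  rw [alternatingMap_sum_apply]
  -- Contracting twice with `(1, x)` gives zero; the Laplace expansion of this zero is the relation.
  have h := (detForm (ℝ × E n) (k + 2) (hbary T ∘ ρ)).map_eq_zero_of_eq
    (Fin.cons (1, x) (Fin.cons (1, x) fun j => LinearMap.inr ℝ ℝ (E n) (w j)))
    (i := 0) (j := 1) rfl (by simp)
  rw [detForm_succ_apply] at h
  refine Eq.trans (Finset.sum_congr rfl fun j _ => ?_) h
  rw [AlternatingMap.smul_apply, smul_eq_mul]
  simp only [Fin.cons_zero, Function.comp_apply, hbary_one]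
  rfl

end Barycentric

/-! ### Polynomials in barycentric coordinates. -/

section Polynomials

/-- Polynomials of degree at most `s` are homogeneous of degree `s` in barycentric
coordinates. -/
theorem eval_mem_span_barycentric_monomials {X ι : Type*} [Fintype ι] [DecidableEq ι] {n : ℕ}
    (y : X → E n) (lam : ι → X → ℝ) (c : ι → E n) (h1 : ∀ x, ∑ i, lam i x = 1)
    (hy : ∀ x, y x = ∑ i, lam i x • c i) (p : MvPolynomial (Fin n) ℝ) {s : ℕ}
    (hp : p.totalDegree ≤ s) :
    (fun x => MvPolynomial.eval (fun j => y x j) p) ∈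
      Submodule.span ℝ
        {g : X → ℝ | ∃ β : ι → ℕ, ∑ i, β i = s ∧ g = fun x => ∏ i, lam i x ^ β i} := by
  set G : Submodule ℝ (X → ℝ) := Submodule.span ℝ (Set.range lam) with hG
  have hlam : ∀ i, lam i ∈ G := fun i => Submodule.subset_span ⟨i, rfl⟩
  have hone : (1 : X → ℝ) ∈ G := by
    have : (1 : X → ℝ) = ∑ i, lam i := by ext x; simp [h1]
    rw [this]
    exact Submodule.sum_mem _ fun i _ => hlam i
  have hcoord : ∀ j, (fun x => y x j) ∈ G := by
    intro j
    have : (fun x => y x j) = ∑ i, c i j • lam i := by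
      ext x; simp [hy, mul_comm]
    rw [this]
    exact Submodule.sum_mem _ fun i _ => Submodule.smul_mem _ _ (hlam i)
  have hpow : G ^ s ≤ Submodule.span ℝ
      {g : X → ℝ | ∃ β : ι → ℕ, ∑ i, β i = s ∧ g = fun x => ∏ i, lam i x ^ β i} := by
    clear hp
    induction s with
    | zero =>
      rw [pow_zero, Submodule.one_eq_span, Submodule.span_le, Set.singleton_subset_iff]
      exact Submodule.subset_span ⟨0, by simp, by ext; simp⟩
    | succ s ih =>
      rw [pow_succ]
      refine (mul_le_mul' ih le_rfl).trans ?_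
      rw [hG, Submodule.span_mul_span, Submodule.span_le]
      rintro _ ⟨_, ⟨β, hβ, rfl⟩, _, ⟨i, rfl⟩, rfl⟩
      refine Submodule.subset_span ⟨β + Pi.single i 1, ?_, ?_⟩
      · simp [Finset.sum_add_distrib, hβ]
      · ext x
        simp only [Pi.mul_apply, Pi.add_apply, pow_add, Finset.prod_mul_distrib]
        congr 1
        rw [Finset.prod_eq_single i]
        · simp
        · intro j _ hj; simp [hj]
        · simp
  refine hpow ?_
  have hsum : (fun x => MvPolynomial.eval (fun j => y x j) p) =
      ∑ m ∈ p.support, p.coeff m • ∏ j, (fun x => y x j) ^ m j := by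
    ext x
    simp [MvPolynomial.eval_eq']
  rw [hsum]
  refine Submodule.sum_mem _ fun m hm => Submodule.smul_mem _ _ ?_
  have hle : ∑ j, m j ≤ s := by
    refine le_trans ?_ ((MvPolynomial.le_totalDegree hm).trans hp)
    rw [Finsupp.sum_fintype _ _ (by simp)]
  have hmem : ∏ j, (fun x => y x j) ^ m j ∈ G ^ ∑ j, m j := by
    generalize (Finset.univ : Finset (Fin n)) = A
    induction A using Finset.induction_on with
    | empty =>
      rw [Finset.prod_empty, Finset.sum_empty, pow_zero]
      exact Submodule.one_le.1 le_rfl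
    | insert a A ha ih =>
      rw [Finset.prod_insert ha, Finset.sum_insert ha, pow_add]
      exact Submodule.mul_mem_mul (Submodule.pow_mem_pow _ (hcoord a) _) ih
  -- The powers of `G` increase because `1 = ∑ lam i` lies in `G`; this is how lower-degree
  -- monomials are homogenized.
  exact pow_le_pow_right₀ (Submodule.one_le.2 hone) hle hmem

variable {n : ℕ} (T : Affine.Simplex ℝ (E n) n)

/-- The polynomial functions of degree at most `s`. -/
def IsPolyFun (s : ℕ) (g : E n → ℝ) : Prop :=
  ∃ p : MvPolynomial (Fin n) ℝ, p.totalDegree ≤ s ∧ ∀ x, g x = MvPolynomial.eval (fun j => x j) p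

theorem isPolyFun_bary (i : Fin (n + 1)) : IsPolyFun 1 (bary T i : E n → ℝ) := by
  refine ⟨MvPolynomial.C (bary T i 0) +
    ∑ j, MvPolynomial.C (dbary T i (EuclideanSpace.single j 1)) * MvPolynomial.X j, ?_, fun x => ?_⟩
  · refine (MvPolynomial.totalDegree_add _ _).trans (max_le (by simp) ?_)
    refine MvPolynomial.totalDegree_finsetSum_le fun j _ => ?_
    exact (MvPolynomial.isHomogeneous_C_mul_X _ _).totalDegree_le
  · rw [bary_eq]
    simp only [map_add, map_sum, map_mul, MvPolynomial.eval_C, MvPolynomial.eval_X]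
    congr 1
    conv_lhs => rw [← (EuclideanSpace.basisFun (Fin n) ℝ).sum_repr x]
    simp [mul_comm]

theorem IsPolyFun.mul {s t : ℕ} {g h : E n → ℝ} (hg : IsPolyFun s g) (hh : IsPolyFun t h) :
    IsPolyFun (s + t) (fun x => g x * h x) := by
  obtain ⟨p, hp, hg⟩ := hg
  obtain ⟨q, hq, hh⟩ := hh
  exact ⟨p * q, (MvPolynomial.totalDegree_mul _ _).trans (add_le_add hp hq), fun x => by
    simp only [map_mul, hg, hh]⟩

theorem isPolyFun_one : IsPolyFun 0 (fun _ : E n => 1) := ⟨1, by simp, by simp⟩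

theorem IsPolyFun.pow {s : ℕ} {g : E n → ℝ} (hg : IsPolyFun s g) (m : ℕ) :
    IsPolyFun (m * s) (fun x => g x ^ m) := by
  induction m with
  | zero => simpa using isPolyFun_one
  | succ m ih => simpa [pow_succ, add_mul] using ih.mul hg

theorem IsPolyFun.prod {ι : Type*} (A : Finset ι) {s : ι → ℕ} {g : ι → E n → ℝ}
    (hg : ∀ i ∈ A, IsPolyFun (s i) (g i)) : IsPolyFun (∑ i ∈ A, s i) (fun x => ∏ i ∈ A, g i x) := by
  classical
  induction A using Finset.induction_on with
  | empty => simpa using isPolyFun_one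
  | insert a A ha ih =>
    simp only [Finset.sum_insert ha, Finset.prod_insert ha]
    exact (hg a (Finset.mem_insert_self _ _)).mul
      (ih fun i hi => hg i (Finset.mem_insert_of_mem hi))

theorem isPolyFun_prod_bary_pow (β : Fin (n + 1) → ℕ) :
    IsPolyFun (∑ i, β i) (fun x => ∏ i, bary T i x ^ β i) := by
  simpa using IsPolyFun.prod Finset.univ fun i _ => (isPolyFun_bary T i).pow (β i)

end Polynomials

/-! ### Barycentric monomials times Whitney forms span `𝒫_r⁻ Λᵏ(T)`. -/

section Whitney

variable {n : ℕ} (T : Affine.Simplex ℝ (E n) n)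

/-- The products of a barycentric monomial `∏ᵢ λᵢ ^ βᵢ` and a Whitney form. -/
def monWhitney {k : ℕ} (β : Fin (n + 1) → ℕ) (v : Fin (k + 1) → Fin (n + 1)) :
    DForm T.closedInterior (E n) k :=
  fun x => (∏ i, bary T i (x : E n) ^ β i) • whitney T v x

/-- `polyTerm` as a linear map in the alternating form. -/
def polyTermₗ (X : Set (E n)) {W : Type*} [AddCommGroup W] [Module ℝ W] (k : ℕ)
    (p : MvPolynomial (Fin n) ℝ) : (W [⋀^Fin k]→ₗ[ℝ] ℝ) →ₗ[ℝ] DForm X W k where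
  toFun := polyTerm X p
  map_add' _ _ := by funext x; exact smul_add _ _ _
  map_smul' c _ := by funext x; exact smul_comm _ c _

/-- Only the top degree `r - 1` needs the Koszul summand. Below it, `κ` raises the degree of the
coefficients by one and stays within `𝒫_{r-1} Λᵏ`. -/
theorem koszul_polyTerm_mem {X : Set (E n)} {r k i : ℕ} (hi : i ≤ r - 1) (hr : 1 ≤ r)
    {p : MvPolynomial (Fin n) ℝ}
    (hp : p.IsHomogeneous i) (α : E n [⋀^Fin (k + 1)]→ₗ[ℝ] ℝ) :
    koszul X k (polyTerm X p α) ∈ polyMinusForms X r k := by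
  rcases hi.eq_or_lt with rfl | hi
  · exact Submodule.mem_sup_right (Submodule.mem_map_of_mem
      (Submodule.subset_span ⟨p, α, hp, rfl⟩))
  · refine Submodule.mem_sup_left ?_
    have : koszul X k (polyTerm X p α) =
        ∑ j, polyTerm X (p * MvPolynomial.X j) (α.curryLeft (EuclideanSpace.single j 1)) := by
      funext x
      rw [Finset.sum_apply]
      have hx : (p.eval fun i => (x : E n) i) • α.curryLeft (x : E n) =
          (p.eval fun i => (x : E n) i) •
            ∑ j, (x : E n) j • α.curryLeft (EuclideanSpace.single j 1) := by
        congr 1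
        conv_lhs => rw [← (EuclideanSpace.basisFun (Fin n) ℝ).sum_repr (x : E n)]
        simp
      refine Eq.trans ?_ (hx.trans ?_)
      · rfl
      · simp [Finset.smul_sum, polyTerm, smul_smul]
    rw [this]
    refine Submodule.sum_mem _ fun j _ => Submodule.subset_span ⟨_, _, ?_, rfl⟩
    have := (hp.mul (MvPolynomial.isHomogeneous_X ℝ j)).totalDegree_le
    omega

theorem koszul_polyTerm_mem_of_totalDegree_le {X : Set (E n)} {r k : ℕ} (hr : 1 ≤ r)
    {p : MvPolynomial (Fin n) ℝ} (hp : p.totalDegree ≤ r - 1) (α : E n [⋀^Fin (k + 1)]→ₗ[ℝ] ℝ) :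
    koszul X k (polyTerm X p α) ∈ polyMinusForms X r k := by
  have : koszul X k (polyTerm X p α) = ∑ i ∈ Finset.range (p.totalDegree + 1),
      koszul X k (polyTerm X (MvPolynomial.homogeneousComponent i p) α) := by
    rw [← map_sum]
    congr 1
    funext x
    rw [Finset.sum_apply]
    simp only [polyTerm]
    rw [← Finset.sum_smul, ← map_sum, MvPolynomial.sum_homogeneousComponent]
  rw [this]
  refine Submodule.sum_mem _ fun i hi => koszul_polyTerm_mem ?_ hr
    (MvPolynomial.homogeneousComponent_isHomogeneous i p) α
  rw [Finset.mem_range] at hi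
  omega

theorem smul_whitney_mem {r k : ℕ} (hr : 1 ≤ r) {g : E n → ℝ} (hg : IsPolyFun (r - 1) g)
    (v : Fin (k + 1) → Fin (n + 1)) :
    (fun x : T.closedInterior => g x • whitney T v (x : E n)) ∈
      polyMinusForms T.closedInterior r k := by
  obtain ⟨p, hp, hg⟩ := hg
  have : (fun x : T.closedInterior => g x • whitney T v (x : E n)) =
      polyTerm T.closedInterior p (whitney T v 0) +
        koszul T.closedInterior k (polyTerm T.closedInterior p
          (detForm (E n) (k + 1) (dbary T ∘ v))) := by
    funext x
    rw [hg, whitney_eq_add, smul_add]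
    rfl
  rw [this]
  refine Submodule.add_mem _ (Submodule.mem_sup_left (Submodule.subset_span ⟨p, _, ?_, rfl⟩))
    (koszul_polyTerm_mem_of_totalDegree_le hr hp _)
  omega

theorem monWhitney_mem {r k : ℕ} (hr : 1 ≤ r) {β : Fin (n + 1) → ℕ} (hβ : ∑ i, β i = r - 1)
    (v : Fin (k + 1) → Fin (n + 1)) :
    monWhitney T β v ∈ polyMinusForms T.closedInterior r k :=
  smul_whitney_mem T hr (hβ ▸ isPolyFun_prod_bary_pow T β) v

theorem smul_whitney_mem_span {s k : ℕ} {p : MvPolynomial (Fin n) ℝ} (hp : p.totalDegree ≤ s)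
    (v : Fin (k + 1) → Fin (n + 1)) :
    (fun x : T.closedInterior => p.eval (fun i => (x : E n) i) • whitney T v (x : E n)) ∈
      Submodule.span ℝ {u | ∃ (β : Fin (n + 1) → ℕ) (v : Fin (k + 1) → Fin (n + 1)),
        ∑ i, β i = s ∧ u = monWhitney T β v} := by
  have h := eval_mem_span_barycentric_monomials (fun x : T.closedInterior => (x : E n))
    (fun i x => bary T i x) T.points (fun x => sum_bary T x) (fun x => (sum_bary_smul T x).symm)
    p hp
  let F : (T.closedInterior → ℝ) →ₗ[ℝ] DForm T.closedInterior (E n) k :=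
    { toFun := fun g x => g x • whitney T v x
      map_add' := fun a b => by funext x; exact add_smul _ _ _
      map_smul' := fun a b => by funext x; exact mul_smul _ _ _ }
  have h2 := Submodule.mem_map_of_mem (f := F) h
  rw [Submodule.map_span] at h2
  refine Submodule.span_mono ?_ h2
  rintro _ ⟨_, ⟨β, hβ, rfl⟩, rfl⟩
  exact ⟨β, v, hβ, rfl⟩

/-- Constant forms are combinations of the `dλ_v`, and each of these is a sum of Whitney forms by
`sum_whitney_cons`. -/
theorem polyTerm_mem_span {s k : ℕ} {p : MvPolynomial (Fin n) ℝ} (hp : p.totalDegree ≤ s)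
    (α : E n [⋀^Fin k]→ₗ[ℝ] ℝ) :
    polyTerm T.closedInterior p α ∈
      Submodule.span ℝ {u | ∃ (β : Fin (n + 1) → ℕ) (v : Fin (k + 1) → Fin (n + 1)),
        ∑ i, β i = s ∧ u = monWhitney T β v} := by
  suffices h : ⊤ ≤ (Submodule.span ℝ {u | ∃ (β : Fin (n + 1) → ℕ)
      (v : Fin (k + 1) → Fin (n + 1)), ∑ i, β i = s ∧ u = monWhitney T β v}).comap
        (polyTermₗ T.closedInterior k p) from h (x := α) trivial
  rw [← span_detForm_dbary T, Submodule.span_le]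
  rintro _ ⟨v, rfl⟩
  have : polyTerm T.closedInterior p (detForm (E n) k (dbary T ∘ v)) =
      ∑ i, fun x : T.closedInterior => p.eval (fun i => (x : E n) i) •
        whitney T (Fin.cons i v : Fin (k + 1) → Fin (n + 1)) (x : E n) := by
    funext x
    rw [Finset.sum_apply, ← Finset.smul_sum, sum_whitney_cons]
    rfl
  change polyTerm T.closedInterior p (detForm (E n) k (dbary T ∘ v)) ∈
    Submodule.span ℝ {u | ∃ (β : Fin (n + 1) → ℕ) (v : Fin (k + 1) → Fin (n + 1)),
      ∑ i, β i = s ∧ u = monWhitney T β v}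
  rw [this]
  exact Submodule.sum_mem _ fun i _ => smul_whitney_mem_span T hp _

/-- By `whitney_eq_add`, `κ (p dλ_v)` is `p φ_v` minus `p` times the constant form `φ_v(0)`; both
are already in the span. -/
theorem koszul_polyTerm_mem_span {s k : ℕ} {p : MvPolynomial (Fin n) ℝ} (hp : p.totalDegree ≤ s)
    (α : E n [⋀^Fin (k + 1)]→ₗ[ℝ] ℝ) :
    koszul T.closedInterior k (polyTerm T.closedInterior p α) ∈
      Submodule.span ℝ {u | ∃ (β : Fin (n + 1) → ℕ) (v : Fin (k + 1) → Fin (n + 1)),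
        ∑ i, β i = s ∧ u = monWhitney T β v} := by
  suffices h : ⊤ ≤ (Submodule.span ℝ {u | ∃ (β : Fin (n + 1) → ℕ)
      (v : Fin (k + 1) → Fin (n + 1)), ∑ i, β i = s ∧ u = monWhitney T β v}).comap
        (koszul T.closedInterior k ∘ₗ polyTermₗ T.closedInterior (k + 1) p) from h (x := α) trivial
  rw [← span_detForm_dbary T, Submodule.span_le]
  rintro _ ⟨v, rfl⟩
  have : koszul T.closedInterior k (polyTerm T.closedInterior p
        (detForm (E n) (k + 1) (dbary T ∘ v))) =
      (fun x : T.closedInterior => p.eval (fun i => (x : E n) i) • whitney T v (x : E n)) -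
        polyTerm T.closedInterior p (whitney T v 0) := by
    funext x
    rw [Pi.sub_apply, whitney_eq_add, smul_add, eq_sub_iff_add_eq, add_comm]
    rfl
  change koszul T.closedInterior k (polyTerm T.closedInterior p
  (detForm (E n) (k + 1) (dbary T ∘ v))) ∈
    Submodule.span ℝ {u | ∃ (β : Fin (n + 1) → ℕ) (v : Fin (k + 1) → Fin (n + 1)),
      ∑ i, β i = s ∧ u = monWhitney T β v}
  rw [this]
  exact Submodule.sub_mem _ (smul_whitney_mem_span T hp v) (polyTerm_mem_span T hp _)

/-- `𝒫_r⁻ Λᵏ(T)` is spanned by the products of barycentric monomials of degree `r - 1` and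
Whitney forms. -/
theorem polyMinusForms_eq_span {r : ℕ} (hr : 1 ≤ r) (k : ℕ) :
    polyMinusForms T.closedInterior r k =
      Submodule.span ℝ {u | ∃ (β : Fin (n + 1) → ℕ) (v : Fin (k + 1) → Fin (n + 1)),
        ∑ i, β i = r - 1 ∧ u = monWhitney T β v} := by
  apply le_antisymm
  · refine sup_le (Submodule.span_le.2 ?_) ?_
    · rintro _ ⟨p, α, hp, rfl⟩
      exact polyTerm_mem_span T (by omega) α
    · rw [homogForms, Submodule.map_span, Submodule.span_le]
      rintro _ ⟨_, ⟨p, α, hp, rfl⟩, rfl⟩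
      exact koszul_polyTerm_mem_span T hp.totalDegree_le α
  · rw [Submodule.span_le]
    rintro _ ⟨β, v, hβ, rfl⟩
    exact monWhitney_mem T hr hβ v

end Whitney

/-! ### Barycentric coordinates of a face and projection onto it. -/

section FaceCoordinates

variable {n k : ℕ} (T : Affine.Simplex ℝ (E n) n) (f : Face n k)

/-- The increasing enumeration of the vertices of a face. -/
def Face.emb : Fin (f.dim + 1) ↪o Fin (n + 1) := f.verts.orderEmbOfFin f.card_verts

theorem Face.emb_mem (j : Fin (f.dim + 1)) : f.emb j ∈ f.verts :=
  Finset.orderEmbOfFin_mem _ _ _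

theorem Face.exists_emb_eq {i : Fin (n + 1)} (hi : i ∈ f.verts) : ∃ j, f.emb j = i := by
  have : i ∈ Set.range f.emb := by
    rw [Face.emb, Finset.range_orderEmbOfFin]; exact hi
  exact this

theorem Face.simplex_points (j : Fin (f.dim + 1)) :
    (f.simplex T).points j = T.points (f.emb j) := rfl

/-- The barycentric coordinates belonging to the vertices of a face. -/
def fbary (x : E n) (j : Fin (f.dim + 1)) : ℝ := bary T (f.emb j) x

/-- The differentials of the barycentric coordinates of a face. -/
def fdual (j : Fin (f.dim + 1)) : tangent (f.simplex T) →ₗ[ℝ] ℝ :=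
  dbary T (f.emb j) ∘ₗ (tangent (f.simplex T)).subtype

theorem bary_eq_zero_of_mem {x : E n} (hx : x ∈ (f.simplex T).closedInterior) {i : Fin (n + 1)}
    (hi : i ∉ f.verts) : bary T i x = 0 := by
  rw [← Affine.Simplex.convexHull_eq_closedInterior] at hx
  have : convexHull ℝ (Set.range (f.simplex T).points) ⊆ (bary T i) ⁻¹' {0} := by
    refine convexHull_min ?_ ((convex_singleton 0).affine_preimage _)
    rintro _ ⟨j, rfl⟩
    rw [Set.mem_preimage, Face.simplex_points, bary_points, if_neg]
    · rfl
    · rintro rfl; exact hi (f.emb_mem j)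
  exact this hx

theorem dbary_eq_zero_of_mem {w : E n} (hw : w ∈ tangent (f.simplex T)) {i : Fin (n + 1)}
    (hi : i ∉ f.verts) : dbary T i w = 0 := by
  have : tangent (f.simplex T) ≤ LinearMap.ker (dbary T i) := by
    rw [tangent, vectorSpan_def, Submodule.span_le]
    rintro _ ⟨_, ⟨a, rfl⟩, _, ⟨b, rfl⟩, rfl⟩
    have h : ∀ a, i ≠ f.emb a := by rintro a rfl; exact hi (f.emb_mem a)
    change dbary T i (T.points (f.emb a) - T.points (f.emb b)) = 0
    rw [dbary_points_sub, if_neg (h a), if_neg (h b), sub_zero]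
  exact this hw

theorem sum_eq_sum_emb {M : Type*} [AddCommMonoid M] {g : Fin (n + 1) → M}
    (hg : ∀ i ∉ f.verts, g i = 0) : ∑ i, g i = ∑ j, g (f.emb j) := by
  refine (Fintype.sum_of_injective f.emb f.emb.injective _ _ ?_ fun _ => rfl).symm
  intro i hi
  exact hg i fun h => hi (f.exists_emb_eq h)

theorem sum_fbary {x : E n} (hx : x ∈ (f.simplex T).closedInterior) : ∑ j, fbary T f x j = 1 := by
  rw [← sum_bary T x]
  exact (sum_eq_sum_emb f fun i hi => bary_eq_zero_of_mem T f hx hi).symm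

theorem sum_fbary_smul {x : E n} (hx : x ∈ (f.simplex T).closedInterior) :
    ∑ j, fbary T f x j • T.points (f.emb j) = x := by
  conv_rhs => rw [← sum_bary_smul T x]
  refine (sum_eq_sum_emb f (g := fun i => bary T i x • T.points i) fun i hi => ?_).symm
  rw [bary_eq_zero_of_mem T f hx hi, zero_smul]

theorem fbary_nonneg {x : E n} (hx : x ∈ T.closedInterior) (j : Fin (f.dim + 1)) :
    0 ≤ fbary T f x j := bary_nonneg T hx _

theorem sum_fdual : ∑ j, fdual T f j = 0 := by
  ext w
  have h := LinearMap.congr_fun (sum_dbary T) (w : E n)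
  rw [LinearMap.sum_apply] at h ⊢
  refine Eq.trans ?_ h
  exact (sum_eq_sum_emb f (g := fun i => dbary T i w) fun i hi =>
    dbary_eq_zero_of_mem T f w.2 hi).symm

theorem fdual_succ_frame (i j : Fin f.dim) :
    fdual T f i.succ (frame (f.simplex T) j) = if i = j then 1 else 0 := by
  change dbary T (f.emb i.succ) (T.points (f.emb j.succ) - T.points (f.emb 0)) = _
  rw [dbary_points_sub]
  simp [Fin.succ_ne_zero]

theorem finrank_tangent : Module.finrank ℝ (tangent (f.simplex T)) = f.dim :=
  (f.simplex T).independent.finrank_vectorSpan (by simp)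

theorem exists_basis_frame : ∃ B : Module.Basis (Fin f.dim) ℝ (tangent (f.simplex T)),
    (∀ i, B i = frame (f.simplex T) i) ∧ ∀ i, B.coord i = fdual T f i.succ :=
  exists_basis_of_dual _ _ (fdual_succ_frame T f) (finrank_tangent T f)

/-- The barycentric coordinates of the point of the simplex with parameter `t`. -/
theorem fbary_param (t : refSimplex f.dim) (j : Fin (f.dim + 1)) :
    fbary T f (param (f.simplex T) t) j =
      (Fin.cons (1 - ∑ i, (t : Fin f.dim → ℝ) i) (t : Fin f.dim → ℝ) : Fin (f.dim + 1) → ℝ) j := by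
  have h : fbary T f (param (f.simplex T) t) j = bary T (f.emb j) (T.points (f.emb 0)) +
      ∑ i, (t : Fin f.dim → ℝ) i *
        dbary T (f.emb j) (T.points (f.emb i.succ) - T.points (f.emb 0)) := by
    rw [fbary, bary_eq, bary_eq T (f.emb j) (T.points (f.emb 0))]
    refine Eq.trans (congrArg (bary T (f.emb j) 0 + ·) ?_) (add_assoc _ _ _).symm
    change dbary T (f.emb j) (T.points (f.emb 0) + ∑ i, (t : Fin f.dim → ℝ) i •
      (T.points (f.emb i.succ) - T.points (f.emb 0))) = _
    rw [map_add, map_sum]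
    simp only [map_smul, smul_eq_mul]
  rw [h, bary_points]
  simp only [dbary_points_sub, EmbeddingLike.apply_eq_iff_eq]
  refine Fin.cases ?_ (fun j => ?_) j
  · simp [(Fin.succ_ne_zero _).symm, sub_eq_add_neg]
  · simp [Fin.succ_ne_zero]

/-- The parameter of the projection to a face along the opposite face. -/
def projParam (x : T.closedInterior) : refSimplex f.dim :=
  -- Where the denominator is zero the parameter is 0. This value is harmless, since the Whitney
  -- forms of `f` vanish at such points.
  ⟨fun j => fbary T f x j.succ / ∑ i, fbary T f x i, fun j =>
    div_nonneg (fbary_nonneg T f x.2 _) (Finset.sum_nonneg fun i _ => fbary_nonneg T f x.2 _), by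
    rw [← Finset.sum_div]
    refine div_le_one_of_le₀ ?_ (Finset.sum_nonneg fun i _ => fbary_nonneg T f x.2 _)
    rw [Fin.sum_univ_succ]
    exact le_add_of_nonneg_left (fbary_nonneg T f x.2 _)⟩

theorem fbary_param_projParam {x : T.closedInterior} (hx : ∑ i, fbary T f x i ≠ 0)
    (j : Fin (f.dim + 1)) :
    fbary T f (param (f.simplex T) (projParam T f x)) j =
      fbary T f x j / ∑ i, fbary T f x i := by
  rw [fbary_param]
  refine Fin.cases ?_ (fun j => ?_) j
  · rw [Fin.cons_zero]
    simp only [projParam]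
    rw [← Finset.sum_div, eq_div_iff hx, sub_mul, div_mul_cancel₀ _ hx, one_mul, Fin.sum_univ_succ]
    ring
  · rw [Fin.cons_succ]
    rfl

theorem param_eq_of_fbary_eq {y z : (f.simplex T).closedInterior}
    (h : ∀ j, fbary T f y j = fbary T f z j) : y = z := by
  ext1
  rw [← sum_fbary_smul T f y.2, ← sum_fbary_smul T f z.2]
  simp only [h]

theorem param_projParam (y : (f.simplex T).closedInterior) :
    param (f.simplex T) (projParam T f ⟨y, f.subset T y.2⟩) = y := by
  have h1 := sum_fbary T f y.2
  refine param_eq_of_fbary_eq T f fun j => ?_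
  rw [fbary_param_projParam]
  · simp [h1]
  · simp [h1]

end FaceCoordinates

/-! ### Extension of test forms from a face to the simplex. -/

section FaceExtension

variable {n k : ℕ} (T : Affine.Simplex ℝ (E n) n) (f : Face n k)

/-- The value of `dλ_{v₁} ∧ … ∧ dλ_{vₖ} ∧ α` at the edge vectors of the face, as an alternating
function of the linear forms. -/
def cofAlt (α : tangent (f.simplex T) [⋀^Fin f.l]→ₗ[ℝ] ℝ) :
    (tangent (f.simplex T) →ₗ[ℝ] ℝ) [⋀^Fin k]→ₗ[ℝ] ℝ :=
  (altEval (frame (f.simplex T)) ∘ₗ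
    (wedgeₗ (tangent (f.simplex T)) k f.l).flip α).compAlternatingMap
      (detForm (tangent (f.simplex T)) k)

/-- The number `(dλ_{v₁} ∧ … ∧ dλ_{vₖ} ∧ α)(frame)`, as a linear function of `α`. -/
def cof (v : Fin k → Fin (f.dim + 1)) :
    (tangent (f.simplex T) [⋀^Fin f.l]→ₗ[ℝ] ℝ) →ₗ[ℝ] ℝ :=
  altEval (frame (f.simplex T)) ∘ₗ
    wedgeₗ (tangent (f.simplex T)) k f.l (detForm (tangent (f.simplex T)) k (fdual T f ∘ v))

theorem cofAlt_apply (α : tangent (f.simplex T) [⋀^Fin f.l]→ₗ[ℝ] ℝ)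
    (v : Fin k → Fin (f.dim + 1)) : cofAlt T f α (fdual T f ∘ v) = cof T f v α := rfl

theorem cof_perm (α : tangent (f.simplex T) [⋀^Fin f.l]→ₗ[ℝ] ℝ)
    (π : Equiv.Perm (Fin f.dim)) :
    cof T f (Fin.succ ∘ π ∘ Fin.castAdd f.l) α =
      (Equiv.Perm.sign π : ℤ) * α (frame (f.simplex T) ∘ π ∘ Fin.natAdd k) :=
  wedge_detForm_apply_of_perm (fdual T f ∘ Fin.succ) α (frame (f.simplex T))
    (fun i j => fdual_succ_frame T f i j) π

/-- Up to sign, wedging with the exterior product of a `k`-tuple of coordinates reads off the value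
of `α` on the complementary edge vectors. Every injective `l`-tuple of edge vectors arises as such a
complement. -/
theorem eq_zero_of_cof_eq_zero {α : tangent (f.simplex T) [⋀^Fin f.l]→ₗ[ℝ] ℝ}
    (h : ∀ v : Fin k → Fin f.dim, cof T f (Fin.succ ∘ v) α = 0) : α = 0 := by
  obtain ⟨B, hB, -⟩ := exists_basis_frame T f
  refine B.ext_alternating fun w hw => ?_
  obtain ⟨π, hπ⟩ := Equiv.Perm.exists_extending_pair (Fin.natAdd k) w
    (Fin.natAdd_injective f.l k) hw
  have h1 := h (π ∘ Fin.castAdd f.l)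
  rw [cof_perm] at h1
  have h2 : (fun i => B (w i)) = frame (f.simplex T) ∘ π ∘ Fin.natAdd k := by
    funext i
    rw [hB, ← hπ]
    rfl
  rw [h2]
  rcases mul_eq_zero.1 h1 with h | h
  · have := sign_mul_sign π
    rw [h] at this
    simp at this
  · rw [h]; rfl

/-- The extension of a test form on the face `f` to a form on `T`: up to constants it maps
`λ^β dλ_τ` to `λ^β λ_τ φ_{f \ τ}`, with `φ` a Whitney form. -/
def faceExt (s : ℕ) :
    DForm (f.simplex T).closedInterior (tangent (f.simplex T)) f.l →ₗ[ℝ]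
      DForm T.closedInterior (E n) k where
  -- Pulling back along the projection divides each barycentric coordinate of `f` by their sum; the
  -- power `s`, the degree of the coefficients of `q`, clears these denominators. The vertex 0
  -- belongs to every Whitney form used, so `v` ranges over the others.
  toFun q x := ∑ v : Fin k → Fin f.dim, (offProd (fbary T f x) (zeroCons v) *
    (∑ j, fbary T f x j) ^ s *
      cof T f (Fin.succ ∘ v) (q (param (f.simplex T) (projParam T f x)))) •
        whitney T (f.emb ∘ zeroCons v) (x : E n)
  map_add' q q' := by
    funext x
    simp only [Pi.add_apply, map_add, mul_add, add_smul, Finset.sum_add_distrib]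
  map_smul' c q := by
    funext x
    simp only [Pi.smul_apply, map_smul, smul_eq_mul, RingHom.id_apply, Finset.smul_sum, smul_smul,
      mul_left_comm]

theorem faceExt_apply (s : ℕ) (q : DForm (f.simplex T).closedInterior (tangent (f.simplex T)) f.l)
    (x : T.closedInterior) :
    faceExt T f s q x = ∑ v : Fin k → Fin f.dim, (offProd (fbary T f x) (zeroCons v) *
    (∑ j, fbary T f x j) ^ s *
      cof T f (Fin.succ ∘ v) (q (param (f.simplex T) (projParam T f x)))) •
        whitney T (f.emb ∘ zeroCons v) (x : E n) := rfl

theorem whitney_eq_zero_of_fbary {x : E n} {m : ℕ} (h : ∀ j, fbary T f x j = 0)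
    (v : Fin (m + 1) → Fin (f.dim + 1)) : whitney T (f.emb ∘ v) x = 0 := by
  rw [whitney_eq_sum]
  refine Finset.sum_eq_zero fun j _ => ?_
  have : bary T ((f.emb ∘ v) j) x = 0 := h (v j)
  rw [this, mul_zero, zero_smul]

/-- The test form `λ^γ α` on a face. -/
def monTest (γ : Fin (f.dim + 1) → ℕ) (α : tangent (f.simplex T) [⋀^Fin f.l]→ₗ[ℝ] ℝ) :
    DForm (f.simplex T).closedInterior (tangent (f.simplex T)) f.l :=
  fun y => (∏ j, fbary T f (y : E n) j ^ γ j) • α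

theorem faceExt_monTest {s : ℕ} {γ : Fin (f.dim + 1) → ℕ} (hγ : ∑ j, γ j = s)
    (α : tangent (f.simplex T) [⋀^Fin f.l]→ₗ[ℝ] ℝ) (x : T.closedInterior) :
    faceExt T f s (monTest T f γ α) x = ∑ v : Fin k → Fin f.dim,
      (offProd (fbary T f x) (zeroCons v) * (∏ j, fbary T f (x : E n) j ^ γ j) *
        cof T f (Fin.succ ∘ v) α) • whitney T (f.emb ∘ zeroCons v) (x : E n) := by
  rw [faceExt_apply]
  refine Finset.sum_congr rfl fun v _ => ?_
  by_cases hx : ∑ j, fbary T f (x : E n) j = 0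
  · rw [Finset.sum_eq_zero_iff_of_nonneg fun j _ => fbary_nonneg T f x.2 j] at hx
    rw [whitney_eq_zero_of_fbary T f fun j => hx j (Finset.mem_univ j)]
    simp
  · congr 1
    rw [monTest, map_smul, smul_eq_mul]
    simp only [fbary_param_projParam T f hx, div_pow, Finset.prod_div_distrib,
      Finset.prod_pow_eq_pow_sum, hγ]
    field_simp

theorem testForms_eq_bot {r : ℕ} (hr : 1 ≤ r) (hl : r - 1 < f.l) : testForms T r f = ⊥ := by
  rw [testForms, polyForms, Submodule.span_eq_bot]
  rintro _ ⟨p, α, hp, -⟩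
  exfalso
  simp only [Face.dim] at hp
  push_cast at hp
  omega

theorem testForms_eq_span {r : ℕ} (hr : 1 ≤ r) (hl : f.l ≤ r - 1) :
    testForms T r f = Submodule.span ℝ {q | ∃ (γ : Fin (f.dim + 1) → ℕ)
      (α : tangent (f.simplex T) [⋀^Fin f.l]→ₗ[ℝ] ℝ), ∑ j, γ j = r - 1 - f.l ∧
        q = monTest T f γ α} := by
  have hs : (r : ℤ) + k - f.dim - 1 = ((r - 1 - f.l : ℕ) : ℤ) := by
    simp only [Face.dim]
    push_cast
    omega
  rw [testForms, hs]
  apply le_antisymm <;> rw [polyForms, Submodule.span_le]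
  · rintro _ ⟨p, α, hp, rfl⟩
    have h := eval_mem_span_barycentric_monomials
      (fun x : (f.simplex T).closedInterior => (x : E n))
      (fun i x => fbary T f x i) (fun j => T.points (f.emb j)) (fun x => sum_fbary T f x.2)
      (fun x => (sum_fbary_smul T f x.2).symm) p (Nat.cast_le.1 hp)
    let F : ((f.simplex T).closedInterior → ℝ) →ₗ[ℝ]
        DForm (f.simplex T).closedInterior (tangent (f.simplex T)) f.l :=
      { toFun := fun g x => g x • α
        map_add' := fun a b => by funext x; exact add_smul _ _ _
        map_smul' := fun a b => by funext x; exact mul_smul _ _ _ }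
    have h2 := Submodule.mem_map_of_mem (f := F) h
    rw [Submodule.map_span] at h2
    refine Submodule.span_mono ?_ h2
    rintro _ ⟨_, ⟨β, hβ, rfl⟩, rfl⟩
    exact ⟨β, α, hβ, rfl⟩
  · rintro _ ⟨γ, α, hγ, rfl⟩
    have h := IsPolyFun.prod Finset.univ fun j _ => (isPolyFun_bary T (f.emb j)).pow (γ j)
    simp only [mul_one, hγ] at h
    obtain ⟨p, hp, h⟩ := h
    refine Submodule.subset_span ⟨p, α, Nat.cast_le.2 hp, ?_⟩
    funext y
    simp only [polyTerm, ← h]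
    rfl

/-- The degrees match: the complementary product has degree `(d + 1) - (k + 1) = l` and the
coefficient of the test form has degree `r - 1 - l`. Tuples with repeated vertices have zero Whitney
form. -/
theorem faceExt_mem {r : ℕ} (hr : 1 ≤ r)
    {q : DForm (f.simplex T).closedInterior (tangent (f.simplex T)) f.l}
    (hq : q ∈ testForms T r f) :
    faceExt T f (r - 1 - f.l) q ∈ polyMinusForms T.closedInterior r k := by
  rcases lt_or_ge (r - 1) f.l with hl | hl
  · rw [testForms_eq_bot T f hr hl, Submodule.mem_bot] at hq
    rw [hq, map_zero]
    exact Submodule.zero_mem _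
  rw [testForms_eq_span T f hr hl] at hq
  suffices h : Submodule.span ℝ _ ≤ (polyMinusForms T.closedInterior r k).comap
    (faceExt T f (r - 1 - f.l)) from h hq
  rw [Submodule.span_le]
  rintro _ ⟨γ, α, hγ, rfl⟩
  change faceExt T f (r - 1 - f.l) (monTest T f γ α) ∈ polyMinusForms T.closedInterior r k
  have : faceExt T f (r - 1 - f.l) (monTest T f γ α) = ∑ v : Fin k → Fin f.dim,
      cof T f (Fin.succ ∘ v) α • fun x : T.closedInterior =>
        (offProd (fbary T f x) (zeroCons v) * (∏ j, fbary T f (x : E n) j ^ γ j)) •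
          whitney T (f.emb ∘ zeroCons v) (x : E n) := by
    funext x
    rw [faceExt_monTest T f hγ, Finset.sum_apply]
    refine Finset.sum_congr rfl fun v _ => ?_
    rw [Pi.smul_apply, smul_smul, mul_comm]
  rw [this]
  refine Submodule.sum_mem _ fun v _ => Submodule.smul_mem _ _ ?_
  by_cases hv : Function.Injective (zeroCons v)
  · refine smul_whitney_mem T hr (g := fun x => offProd (fbary T f x) (zeroCons v) *
      (∏ j, fbary T f (x : E n) j ^ γ j)) ?_ _
    have h1 := IsPolyFun.prod Finset.univ fun j _ => (isPolyFun_bary T (f.emb j)).pow (γ j)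
    have h2 := IsPolyFun.prod (Finset.univ.image (zeroCons v))ᶜ
      fun j _ => isPolyFun_bary T (f.emb j)
    have h3 := h2.mul h1
    simp only [mul_one, hγ, Finset.sum_const, smul_eq_mul, Finset.card_compl, Fintype.card_fin,
      Finset.card_image_of_injective _ hv, Finset.card_univ] at h3
    have h4 : f.dim + 1 - (k + 1) + (r - 1 - f.l) = r - 1 := by
      simp only [Face.dim]; omega
    rw [h4] at h3
    exact h3
  · have : ∀ x, whitney T (f.emb ∘ zeroCons v) x = 0 := fun x =>
      whitney_eq_zero_of_not_injective T (fun h => hv h.of_comp) x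
    simp only [this, smul_zero]
    exact Submodule.zero_mem _

/-- The extension from `f` has vanishing trace on all faces that do not contain `f`. -/
theorem trace_faceExt_eq_zero (s : ℕ)
    (q : DForm (f.simplex T).closedInterior (tangent (f.simplex T)) f.l) (g : Face n k)
    (hfg : ¬ f.verts ⊆ g.verts) :
    trace (g.subset T) (tangent (g.simplex T)) (faceExt T f s q) = 0 := by
  obtain ⟨i, hif, hig⟩ := Finset.not_subset.1 hfg
  obtain ⟨j, rfl⟩ := f.exists_emb_eq hif
  funext y
  ext w
  rw [trace, AlternatingMap.compLinearMap_apply, faceExt_apply, alternatingMap_sum_apply]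
  refine Finset.sum_eq_zero fun v _ => ?_
  have hy : bary T (f.emb j) y = 0 := bary_eq_zero_of_mem T g y.2 hig
  rw [AlternatingMap.smul_apply]
  -- The coordinate of a vertex of `f` outside `g` vanishes on `g` along with its differential. It
  -- occurs in every term, either in the Whitney form or in the complementary product.
  by_cases hj : j ∈ Finset.univ.image (zeroCons v)
  · obtain ⟨m, -, hm⟩ := Finset.mem_image.1 hj
    rw [whitney, AlternatingMap.compLinearMap_apply, AlternatingMap.curryLeft_apply_apply,
      detForm_apply, Matrix.det_eq_zero_of_column_eq_zero m, smul_zero]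
    intro a
    refine Fin.cases ?_ (fun a => ?_) a
    · simp [hm, hbary_one, hy]
    · simp [hm, hbary_apply, dbary_eq_zero_of_mem T g (w a).2 hig]
  · have : offProd (fbary T f (y : E n)) (zeroCons v) = 0 :=
      Finset.prod_eq_zero (i := j) (Finset.mem_compl.2 hj) hy
    rw [this]
    simp

/-- On `f` itself the projection is the identity and the coordinates sum to one, so the pairing
takes the shape treated by `sum_sq_le_sum_zeroCons`. -/
theorem wedge_trace_faceExt (s : ℕ)
    (q : DForm (f.simplex T).closedInterior (tangent (f.simplex T)) f.l)
    (y : (f.simplex T).closedInterior) :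
    wedge (trace (f.subset T) (tangent (f.simplex T)) (faceExt T f s q) y) (q y)
        (frame (f.simplex T)) =
      ∑ v : Fin k → Fin f.dim, offProd (fbary T f (y : E n)) (zeroCons v) *
        cofAlt T f (q y) (fdual T f ∘ Fin.succ ∘ v) *
        ∑ j : Fin (k + 1), (-1) ^ (j : ℕ) * fbary T f (y : E n) (zeroCons v j) *
          cofAlt T f (q y) (fdual T f ∘ zeroCons v ∘ j.succAbove) := by
  have h : trace (f.subset T) (tangent (f.simplex T)) (faceExt T f s q) y =
      ∑ v : Fin k → Fin f.dim, ∑ j : Fin (k + 1),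
        (offProd (fbary T f (y : E n)) (zeroCons v) *
          cofAlt T f (q y) (fdual T f ∘ Fin.succ ∘ v) *
            ((-1) ^ (j : ℕ) * fbary T f (y : E n) (zeroCons v j))) •
          detForm (tangent (f.simplex T)) k (fdual T f ∘ zeroCons v ∘ j.succAbove) := by
    ext w
    rw [trace, AlternatingMap.compLinearMap_apply, faceExt_apply, param_projParam]
    simp only [alternatingMap_sum_apply, AlternatingMap.smul_apply, whitney_eq_sum, Finset.smul_sum,
      smul_smul, sum_fbary T f y.2, one_pow, mul_one]
    rfl
  rw [h, ← wedgeₗ_apply, ← altEval_apply]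
  simp only [map_sum, map_smul, LinearMap.sum_apply, LinearMap.smul_apply, Finset.mul_sum,
    smul_eq_mul]
  refine Finset.sum_congr rfl fun v _ => Finset.sum_congr rfl fun j _ => ?_
  rw [mul_assoc (_ * _)]
  rfl

theorem sum_sq_le_wedge_trace_faceExt (s : ℕ)
    (q : DForm (f.simplex T).closedInterior (tangent (f.simplex T)) f.l)
    (y : (f.simplex T).closedInterior) :
    ∑ v : Fin k → Fin f.dim, offProd (fbary T f (y : E n)) (zeroCons v) *
        fbary T f (y : E n) 0 * cof T f (Fin.succ ∘ v) (q y) ^ 2 ≤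
      wedge (trace (f.subset T) (tangent (f.simplex T)) (faceExt T f s q) y) (q y)
        (frame (f.simplex T)) := by
  rw [wedge_trace_faceExt]
  exact sum_sq_le_sum_zeroCons (fun j => fbary_nonneg T f (f.subset T y.2) j) (fdual T f)
    (sum_fdual T f) (cofAlt T f (q y))

end FaceExtension

/-! ### The extensions span `𝒫_r⁻ Λᵏ(T)`. -/

section Spanning

theorem zeroCons_injective {d k : ℕ} {v : Fin k → Fin d} (hv : Function.Injective v) :
    Function.Injective (zeroCons v) := by
  rw [zeroCons, Fin.cons_injective_iff]
  refine ⟨?_, (Fin.succ_injective _).comp hv⟩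
  rintro ⟨a, ha⟩
  exact Fin.succ_ne_zero _ ha

theorem zeroCons_comp_perm {d k : ℕ} (v : Fin k → Fin d) (π : Equiv.Perm (Fin k)) :
    zeroCons (v ∘ π) = zeroCons v ∘ Equiv.Perm.decomposeFin.symm (0, π) := by
  funext a
  refine Fin.cases ?_ (fun a => ?_) a <;> simp [zeroCons]

theorem offProd_zeroCons_comp_perm {d k : ℕ} (lam : Fin (d + 1) → ℝ) (v : Fin k → Fin d)
    (π : Equiv.Perm (Fin k)) : offProd lam (zeroCons (v ∘ π)) = offProd lam (zeroCons v) := by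
  have : Finset.univ.image (zeroCons (v ∘ π)) = Finset.univ.image (zeroCons v) := by
    rw [zeroCons_comp_perm]
    ext a
    simp only [Finset.mem_image, Finset.mem_univ, true_and, Function.comp_apply]
    exact (Equiv.surjective (Equiv.Perm.decomposeFin.symm (0, π))).exists
      (p := fun b => zeroCons v b = a) |>.symm
  rw [offProd, offProd, this]

variable {n k : ℕ} (T : Affine.Simplex ℝ (E n) n)

theorem whitney_zeroCons_comp_perm (f : Face n k) (v : Fin k → Fin f.dim)
    (π : Equiv.Perm (Fin k)) (x : E n) :
    whitney T (f.emb ∘ zeroCons (v ∘ π)) x =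
      ((Equiv.Perm.sign π : ℤ) : ℝ) • whitney T (f.emb ∘ zeroCons v) x := by
  rw [zeroCons_comp_perm, ← Function.comp_assoc, whitney_comp_perm,
    Equiv.Perm.decomposeFin.symm_sign]
  simp

theorem cof_comp_perm (f : Face n k) (v : Fin k → Fin (f.dim + 1)) (π : Equiv.Perm (Fin k))
    (α : tangent (f.simplex T) [⋀^Fin f.l]→ₗ[ℝ] ℝ) :
    cof T f (v ∘ π) α = ((Equiv.Perm.sign π : ℤ) : ℝ) * cof T f v α :=
  map_comp_perm (cofAlt T f α) (fdual T f ∘ v) π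

/-- Pairing with the form `dλ_w` of complementary vertices. -/
theorem cof_detForm_eq_zero_or (f : Face n k) (π : Equiv.Perm (Fin f.dim)) (v : Fin k → Fin f.dim) :
    cof T f (Fin.succ ∘ v) (detForm (tangent (f.simplex T)) f.l
        (fdual T f ∘ Fin.succ ∘ π ∘ Fin.natAdd k)) = 0 ∨
      ∃ ϖ : Equiv.Perm (Fin k), v = (π ∘ Fin.castAdd f.l) ∘ ϖ := by
  by_cases hv : Function.Injective v
  swap
  · left
    rw [← cofAlt_apply, AlternatingMap.map_eq_zero_of_not_injective]
    intro h
    apply hv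
    intro a b hab
    exact h (by simp [hab])
  by_cases hd : ∃ a j, v a = π (Fin.natAdd k j)
  · left
    obtain ⟨a, j, haj⟩ := hd
    obtain ⟨σ, rfl⟩ := exists_perm_castAdd hv
    rw [cof_perm, detForm_apply, Matrix.det_eq_zero_of_column_eq_zero j, mul_zero]
    intro i
    rw [Matrix.of_apply]
    simp only [Function.comp_apply] at haj ⊢
    rw [← haj, fdual_succ_frame, if_neg]
    intro h
    have := congrArg Fin.val (σ.injective h)
    simp at this
    omega
  · right
    push Not at hd
    have h : ∀ a, ∃ b, v a = π (Fin.castAdd f.l b) := by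
      intro a
      have h1 : π (π.symm (v a)) = v a := π.apply_symm_apply _
      revert h1
      refine Fin.addCases (fun b h1 => ⟨b, h1.symm⟩) (fun j h1 => absurd h1.symm (hd a j))
        (π.symm (v a))
    choose g hg using h
    have hgi : Function.Injective g := fun a b hab => hv (by rw [hg, hg, hab])
    exact ⟨Equiv.ofBijective g (Finite.injective_iff_bijective.1 hgi), funext hg⟩

theorem cof_detForm_self (f : Face n k) (π : Equiv.Perm (Fin f.dim)) :
    cof T f (Fin.succ ∘ π ∘ Fin.castAdd f.l) (detForm (tangent (f.simplex T)) f.l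
        (fdual T f ∘ Fin.succ ∘ π ∘ Fin.natAdd k)) = (Equiv.Perm.sign π : ℤ) := by
  rw [cof_perm, detForm_apply]
  convert mul_one _
  convert Matrix.det_one (n := Fin f.l) (R := ℝ) using 2
  ext i j
  simp [fdual_succ_frame, Matrix.one_apply, eq_comm]

/-- The sum of the spaces of extensions of test forms on the faces. -/
def extSpan (r k : ℕ) : Submodule ℝ (DForm T.closedInterior (E n) k) :=
  ⨆ f : Face n k, (testForms T r f).map (faceExt T f (r - 1 - f.l))

/-- By `hvβ` the monomial is divisible by the product of the coordinates of `f` outside `(0, v)`.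
Let `γ` be the exponent of the quotient and `α` the exterior product of the differentials of the
omitted vertices. The extension of `λ^γ α` is a nonzero multiple of the given product. -/
theorem monWhitney_emb_zeroCons_mem {r : ℕ} (hr : 1 ≤ r) (f : Face n k) {v : Fin k → Fin f.dim}
    (hv : Function.Injective v) {β : Fin (n + 1) → ℕ} (hβ : ∑ i, β i = r - 1)
    (hf : ∀ i, i ∉ f.verts → β i = 0)
    (hvβ : ∀ j ∉ Finset.univ.image (zeroCons v), β (f.emb j) ≠ 0) :
    monWhitney T β (f.emb ∘ zeroCons v) ∈ extSpan T r k := by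
  obtain ⟨π, rfl⟩ := exists_perm_castAdd hv
  set v := π ∘ Fin.castAdd f.l with hvdef
  set A := Finset.univ.image (zeroCons v)
  let γ : Fin (f.dim + 1) → ℕ := fun j => β (f.emb j) - if j ∈ A then 0 else 1
  have hγ : ∀ j, γ j + (if j ∈ A then 0 else 1) = β (f.emb j) := by
    intro j
    by_cases hj : j ∈ A
    · simp [γ, hj]
    · have := hvβ j hj
      simp only [γ, hj, if_false]
      omega
  have hsum : ∑ j, γ j + f.l = r - 1 := by
    rw [← hβ, sum_eq_sum_emb f hf, ← Finset.sum_congr rfl fun j _ => hγ j, Finset.sum_add_distrib]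
    congr 1
    rw [Finset.sum_ite]
    simp only [Finset.sum_const_zero, zero_add, Finset.sum_const, smul_eq_mul, mul_one]
    have : Finset.univ.filter (fun j => j ∉ A) = Aᶜ := by ext; simp
    rw [this, Finset.card_compl, Finset.card_image_of_injective _ (zeroCons_injective hv)]
    simp [Face.dim]
  set α := detForm (tangent (f.simplex T)) f.l (fdual T f ∘ Fin.succ ∘ π ∘ Fin.natAdd k) with hα
  have hq : monTest T f γ α ∈ testForms T r f := by
    rw [testForms_eq_span T f hr (by omega)]
    exact Submodule.subset_span ⟨γ, α, by omega, rfl⟩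
  have hprod : ∀ x : E n, offProd (fbary T f x) (zeroCons v) * ∏ j, fbary T f x j ^ γ j =
      ∏ i, bary T i x ^ β i := by
    intro x
    have h1 : ∏ i, bary T i x ^ β i = ∏ j, fbary T f x j ^ β (f.emb j) := by
      refine (Fintype.prod_of_injective f.emb f.emb.injective _ _ ?_ fun _ => rfl).symm
      intro i hi
      rw [hf i fun h => hi (f.exists_emb_eq h), pow_zero]
    have h2 : offProd (fbary T f x) (zeroCons v) =
        ∏ j, fbary T f x j ^ (if j ∈ A then 0 else 1) := by
      rw [offProd, ← Finset.prod_subset (Finset.subset_univ Aᶜ)]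
      · refine Finset.prod_congr rfl fun j hj => ?_
        rw [if_neg (Finset.mem_compl.1 hj), pow_one]
      · intro j _ hj
        rw [if_pos (by simpa using hj), pow_zero]
    rw [h1, h2, ← Finset.prod_mul_distrib]
    refine Finset.prod_congr rfl fun j _ => ?_
    rw [← pow_add, ← hγ j, add_comm]
  -- Only rearrangements of `v` contribute. The rearrangement changes the sign of both `cof` and the
  -- Whitney form, so the contributions coincide and cannot cancel.
  have hterm : ∀ u : Fin k → Fin f.dim, ∃ χ : ℝ, 0 ≤ χ ∧ (u = v → χ = 1) ∧
      ∀ x : E n, (offProd (fbary T f x) (zeroCons u) * (∏ j, fbary T f (x : E n) j ^ γ j) *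
        cof T f (Fin.succ ∘ u) α) • whitney T (f.emb ∘ zeroCons u) (x : E n) =
        (χ * (Equiv.Perm.sign π : ℤ)) •
          ((∏ i, bary T i x ^ β i) • whitney T (f.emb ∘ zeroCons v) x) := by
    intro u
    rcases cof_detForm_eq_zero_or T f π u with h | ⟨ϖ, hϖ⟩
    · refine ⟨0, le_rfl, ?_, fun x => ?_⟩
      · rintro rfl
        rw [cof_detForm_self] at h
        have := sign_mul_sign π
        rw [h] at this
        simp at this
      · rw [hα, h]
        simp
    · refine ⟨1, zero_le_one, fun _ => rfl, fun x => ?_⟩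
      rw [← hvdef] at hϖ
      rw [hϖ, offProd_zeroCons_comp_perm, whitney_zeroCons_comp_perm, hprod,
        ← Function.comp_assoc, cof_comp_perm, smul_smul, smul_smul, hα, hvdef, cof_detForm_self]
      congr 1
      linear_combination ((∏ i, bary T i x ^ β i) * (Equiv.Perm.sign π : ℤ)) * sign_mul_sign ϖ
  choose χ h0 h1 hχ using hterm
  have hext : faceExt T f (r - 1 - f.l) (monTest T f γ α) =
      ((∑ u, χ u) * (Equiv.Perm.sign π : ℤ)) • monWhitney T β (f.emb ∘ zeroCons v) := by
    funext x
    rw [faceExt_monTest T f (by omega), Finset.sum_congr rfl fun u _ => hχ u x, ← Finset.sum_smul,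
      ← Finset.sum_mul]
    rfl
  have hpos : 0 < ∑ u, χ u := by
    have : χ v ≤ ∑ u, χ u := Finset.single_le_sum (fun u _ => h0 u) (Finset.mem_univ v)
    rw [h1 v rfl] at this
    linarith
  have hne : (∑ u, χ u) * ((Equiv.Perm.sign π : ℤ) : ℝ) ≠ 0 := by
    refine mul_ne_zero hpos.ne' fun h => ?_
    have := sign_mul_sign π
    rw [h] at this
    simp at this
  rw [← inv_smul_smul₀ hne (monWhitney T β _), ← hext]
  exact Submodule.smul_mem _ _ (Submodule.mem_iSup_of_mem f (Submodule.mem_map_of_mem hq))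

/-- The products of a barycentric monomial and a Whitney form in which the first vertex of the
Whitney form is the least vertex that occurs. -/
theorem monWhitney_mem_of_le {r : ℕ} (hr : 1 ≤ r) {v : Fin (k + 1) → Fin (n + 1)}
    (hv : Function.Injective v) {β : Fin (n + 1) → ℕ} (hβ : ∑ i, β i = r - 1)
    (hmin : ∀ j, v 0 ≤ v j) (hminβ : ∀ i, β i ≠ 0 → v 0 ≤ i) :
    monWhitney T β v ∈ extSpan T r k := by
  let F : Finset (Fin (n + 1)) := Finset.univ.filter (fun i => β i ≠ 0) ∪ Finset.univ.image v
  have hFv : ∀ j, v j ∈ F := fun j =>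
    Finset.mem_union_right _ (Finset.mem_image_of_mem _ (Finset.mem_univ j))
  have hcard : k + 1 ≤ F.card := by
    have := Finset.card_le_card (Finset.subset_union_right : Finset.univ.image v ⊆ F)
    rwa [Finset.card_image_of_injective _ hv, Finset.card_univ, Fintype.card_fin] at this
  let f : Face n k := ⟨F.card - (k + 1), F, by omega⟩
  have hle : ∀ i ∈ F, v 0 ≤ i := by
    intro i hi
    rcases Finset.mem_union.1 hi with h | h
    · exact hminβ i (Finset.mem_filter.1 h).2
    · obtain ⟨j, -, rfl⟩ := Finset.mem_image.1 h
      exact hmin j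
  -- The vertices of a face are enumerated in increasing order, so minimality of `v 0` makes it the
  -- distinguished vertex of the face of all vertices that occur.
  have h0 : f.emb 0 = v 0 := by
    obtain ⟨j, hj⟩ := f.exists_emb_eq (hFv 0)
    refine le_antisymm ?_ (hle _ (f.emb_mem 0))
    rw [← hj]
    exact f.emb.monotone (Fin.zero_le j)
  have hex : ∀ a : Fin k, ∃ b : Fin f.dim, f.emb b.succ = v a.succ := by
    intro a
    obtain ⟨j, hj⟩ := f.exists_emb_eq (hFv a.succ)
    have hj0 : j ≠ 0 := by
      rintro rfl
      exact Fin.succ_ne_zero a (hv (hj.symm.trans h0))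
    obtain ⟨b, rfl⟩ := Fin.exists_succ_eq.2 hj0
    exact ⟨b, hj⟩
  choose u hu using hex
  have huv : f.emb ∘ zeroCons u = v := by
    funext a
    refine Fin.cases ?_ (fun a => ?_) a
    · simp [zeroCons, h0]
    · simp [zeroCons, hu]
  have hui : Function.Injective u := by
    intro a b hab
    have : v a.succ = v b.succ := by rw [← hu, ← hu, hab]
    exact Fin.succ_injective _ (hv this)
  rw [← huv]
  refine monWhitney_emb_zeroCons_mem T hr f hui hβ (fun i hi => ?_) fun j hj => ?_
  · by_contra h
    exact hi (Finset.mem_union_left _ (by simpa using h))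
  · rcases Finset.mem_union.1 (f.emb_mem j) with h | h
    · exact (Finset.mem_filter.1 h).2
    · obtain ⟨a, -, ha⟩ := Finset.mem_image.1 h
      rw [← huv] at ha
      exact absurd (Finset.mem_image.2 ⟨a, Finset.mem_univ a, f.emb.injective ha⟩) hj

/-- Let `m` be the least vertex that occurs. If it is an entry of `v`, a transposition moves it to
the front. Otherwise `λ_m` divides the monomial, and the relation for the tuple `(m, v)` replaces
`λ_m φ_v` by products of some `λ_{v_j}` with Whitney forms that start with `m`; no smaller vertex
appears. -/
theorem monWhitney_mem_extSpan {r : ℕ} (hr : 1 ≤ r) (v : Fin (k + 1) → Fin (n + 1))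
    {β : Fin (n + 1) → ℕ} (hβ : ∑ i, β i = r - 1) :
    monWhitney T β v ∈ extSpan T r k := by
  by_cases hv : Function.Injective v
  swap
  · have : monWhitney T β v = 0 := by
      funext x
      rw [monWhitney, whitney_eq_zero_of_not_injective T hv, smul_zero]
      rfl
    rw [this]
    exact Submodule.zero_mem _
  let F : Finset (Fin (n + 1)) := Finset.univ.filter (fun i => β i ≠ 0) ∪ Finset.univ.image v
  have hFv : ∀ j, v j ∈ F := fun j =>
    Finset.mem_union_right _ (Finset.mem_image_of_mem _ (Finset.mem_univ j))
  have hFβ : ∀ i, β i ≠ 0 → i ∈ F := fun i hi =>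
    Finset.mem_union_left _ (by simpa using hi)
  have hF : F.Nonempty := ⟨v 0, hFv 0⟩
  set m := F.min' hF
  have hm : ∀ i ∈ F, m ≤ i := fun i hi => F.min'_le i hi
  by_cases hmv : ∃ j, v j = m
  · obtain ⟨j, hj⟩ := hmv
    have h0 : (v ∘ Equiv.swap 0 j) 0 = m := by simp [hj]
    have h1 := monWhitney_mem_of_le T hr (v := v ∘ Equiv.swap 0 j)
      (hv.comp (Equiv.injective _)) hβ (fun a => h0 ▸ hm _ (hFv _))
      (fun i hi => h0 ▸ hm _ (hFβ i hi))
    have h2 : monWhitney T β v =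
        ((Equiv.Perm.sign (Equiv.swap 0 j) : ℤ) : ℝ) • monWhitney T β (v ∘ Equiv.swap 0 j) := by
      funext x
      rw [Pi.smul_apply, monWhitney, monWhitney, whitney_comp_perm, smul_comm, smul_smul,
        smul_smul, mul_assoc, sign_mul_sign, mul_one]
    rw [h2]
    exact Submodule.smul_mem _ _ h1
  · push Not at hmv
    have hβm : β m ≠ 0 := by
      rcases Finset.mem_union.1 (F.min'_mem hF) with h | h
      · exact (Finset.mem_filter.1 h).2
      · obtain ⟨j, -, hj⟩ := Finset.mem_image.1 h
        exact absurd hj (hmv j)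
    let ρ : Fin (k + 2) → Fin (n + 1) := Fin.cons m v
    have hρ : Function.Injective ρ := by
      rw [Fin.cons_injective_iff]
      exact ⟨fun ⟨j, hj⟩ => hmv j hj, hv⟩
    let β₀ : Fin (n + 1) → ℕ := β - Pi.single m 1
    have hβ₀ : β₀ + Pi.single m 1 = β := by
      refine tsub_add_cancel_of_le fun i => ?_
      rcases eq_or_ne i m with rfl | hi
      · simp only [Pi.single_eq_same]; omega
      · simp [hi]
    have hmon : ∀ (i : Fin (n + 1)) (x : E n), ∏ a, bary T a x ^ (β₀ + Pi.single i 1 : _ → ℕ) a =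
        (∏ a, bary T a x ^ β₀ a) * bary T i x := by
      intro i x
      simp only [Pi.add_apply, pow_add, Finset.prod_mul_distrib]
      congr 1
      rw [Finset.prod_eq_single i]
      · simp
      · intro j _ hj; simp [hj]
      · simp
    have hrel : monWhitney T β v = -∑ j : Fin (k + 1), ((-1 : ℝ) ^ (j.succ : ℕ)) •
        monWhitney T (β₀ + Pi.single (v j) 1) (ρ ∘ j.succ.succAbove) := by
      funext x
      have h := sum_bary_smul_whitney T ρ (x : E n)
      rw [Fin.sum_univ_succ] at h
      have h0 : ρ ∘ (0 : Fin (k + 2)).succAbove = v := by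
        funext a; simp [ρ]
      have h1 : ρ 0 = m := rfl
      rw [h0, h1, Fin.val_zero, pow_zero, one_mul, ← eq_neg_iff_add_eq_zero] at h
      rw [Pi.neg_apply, Finset.sum_apply, monWhitney, ← hβ₀, hmon, mul_smul, h, smul_neg,
        Finset.smul_sum]
      congr 1
      refine Finset.sum_congr rfl fun j _ => ?_
      rw [Pi.smul_apply, monWhitney, hmon, smul_smul, smul_smul]
      congr 1
      simp only [ρ, Fin.cons_succ]
      ring
    rw [hrel]
    refine Submodule.neg_mem _ (Submodule.sum_mem _ fun j _ => Submodule.smul_mem _ _ ?_)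
    have h0 : (ρ ∘ j.succ.succAbove) 0 = m := by
      have : j.succ.succAbove 0 = 0 := by simp
      simp [ρ, this]
    refine monWhitney_mem_of_le T hr (hρ.comp Fin.succAbove_right_injective) ?_ (fun a => ?_)
      fun i hi => ?_
    · have h1 : ∑ i, β₀ i + 1 = r - 1 := by
        rw [← hβ, ← hβ₀]
        simp [Finset.sum_add_distrib]
      simp [Finset.sum_add_distrib, h1]
    · rw [h0]
      simp only [Function.comp_apply]
      generalize j.succ.succAbove a = b
      refine Fin.cases ?_ (fun b => ?_) b
      · exact le_rfl
      · exact hm _ (hFv b)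
    · rw [h0]
      by_cases h : i = v j
      · rw [h]; exact hm _ (hFv j)
      · refine hm _ (hFβ i ?_)
        simp only [Pi.add_apply, Pi.single_apply, h, if_false, add_zero, β₀, Pi.sub_apply] at hi
        omega

theorem extSpan_eq_polyMinusForms {r : ℕ} (hr : 1 ≤ r) :
    extSpan T r k = polyMinusForms T.closedInterior r k := by
  apply le_antisymm
  · refine iSup_le fun f => ?_
    rintro _ ⟨q, hq, rfl⟩
    exact faceExt_mem T f hr hq
  · rw [polyMinusForms_eq_span T hr, Submodule.span_le]
    rintro _ ⟨β, v, hβ, rfl⟩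
    exact monWhitney_mem_extSpan T hr v hβ

end Spanning

/-! ### Topology and measure of the reference simplex. -/

section ReferenceSimplex

open Topology Filter

theorem isOpen_posSimplex (d : ℕ) :
    IsOpen {t : Fin d → ℝ | (∀ i, 0 < t i) ∧ ∑ i, t i < 1} := by
  refine IsOpen.and ?_ ?_
  · simp only [Set.ofPred_forall]
    exact isOpen_iInter_of_finite fun i => isOpen_lt continuous_const (continuous_apply i)
  · exact isOpen_lt (by fun_prop) continuous_const

/-- A point is the limit of its convex combinations with the barycenter, all of whose coordinates
are `1 / (d + 1)`. -/
theorem refSimplex_subset_closure (d : ℕ) :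
    refSimplex d ⊆ closure {t : Fin d → ℝ | (∀ i, 0 < t i) ∧ ∑ i, t i < 1} := by
  intro t ht
  let c : ℝ := 1 / (d + 1)
  have hc : 0 < c := by positivity
  have hdc : d * c < 1 := by
    simp only [c, mul_one_div]
    rw [div_lt_one (by positivity)]
    linarith
  have hlim : Tendsto (fun s : ℝ => fun i => (1 - s) * t i + s * c) (𝓝[>] 0) (𝓝 t) := by
    have : Continuous (fun s : ℝ => fun i => (1 - s) * t i + s * c) := by fun_prop
    have h := this.tendsto 0
    simp only [sub_zero, one_mul, zero_mul, add_zero] at h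
    exact h.mono_left nhdsWithin_le_nhds
  refine mem_closure_of_tendsto hlim ?_
  filter_upwards [Ioo_mem_nhdsGT (zero_lt_one' ℝ)] with s hs
  refine ⟨fun i => ?_, ?_⟩
  · have := mul_nonneg (sub_nonneg.2 hs.2.le) (ht.1 i)
    have := mul_pos hs.1 hc
    linarith
  · rw [Finset.sum_add_distrib, ← Finset.mul_sum]
    simp only [Finset.sum_const, Finset.card_univ, Fintype.card_fin, nsmul_eq_mul]
    have h1 : (1 - s) * ∑ i, t i ≤ (1 - s) * 1 :=
      mul_le_mul_of_nonneg_left ht.2 (sub_nonneg.2 hs.2.le)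
    have h2 : s * (d * c) < s * 1 := mul_lt_mul_of_pos_left hdc hs.1
    nlinarith

theorem isCompact_refSimplex (d : ℕ) : IsCompact (refSimplex d) := by
  have hclosed : IsClosed (refSimplex d) := by
    refine IsClosed.and ?_ ?_
    · simp only [Set.ofPred_forall]
      exact isClosed_iInter fun i => isClosed_le continuous_const (continuous_apply i)
    · exact isClosed_le (by fun_prop) continuous_const
  refine (isCompact_Icc (a := (0 : Fin d → ℝ)) (b := 1)).of_isClosed_subset hclosed ?_
  intro t ht
  refine ⟨fun i => ht.1 i, fun i => ?_⟩
  exact (Finset.single_le_sum (fun j _ => ht.1 j) (Finset.mem_univ i)).trans ht.2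

instance (d : ℕ) : CompactSpace (refSimplex d) :=
  isCompact_iff_compactSpace.1 (isCompact_refSimplex d)

/-- Lebesgue measure on the reference simplex. -/
abbrev refMeasure (d : ℕ) : Measure (refSimplex d) := Measure.comap Subtype.val volume

theorem refMeasure_apply {d : ℕ} (U : Set (refSimplex d)) :
    refMeasure d U = volume (Subtype.val '' U) :=
  (MeasurableEmbedding.subtype_coe (isCompact_refSimplex d).measurableSet).comap_apply _ _

instance (d : ℕ) : IsFiniteMeasure (refMeasure d) :=
  ⟨by
    rw [refMeasure_apply, Set.image_univ, Subtype.range_coe]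
    exact (isCompact_refSimplex d).measure_lt_top⟩

theorem exists_pos_mem_of_isOpen {d : ℕ} {O : Set (Fin d → ℝ)} (hO : IsOpen O)
    {t : Fin d → ℝ} (ht : t ∈ refSimplex d) (htO : t ∈ O) :
    (O ∩ {t : Fin d → ℝ | (∀ i, 0 < t i) ∧ ∑ i, t i < 1}).Nonempty :=
  mem_closure_iff.1 (refSimplex_subset_closure d ht) O hO htO

theorem posSimplex_subset_refSimplex (d : ℕ) :
    {t : Fin d → ℝ | (∀ i, 0 < t i) ∧ ∑ i, t i < 1} ⊆ refSimplex d :=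
  fun _ ht => ⟨fun i => (ht.1 i).le, ht.2.le⟩

/-- A nonempty relatively open set, even one around a boundary point, meets the open simplex in a
nonempty open subset of `ℝᵈ`. -/
instance (d : ℕ) : (refMeasure d).IsOpenPosMeasure := by
  refine ⟨fun U hU hne h0 => ?_⟩
  obtain ⟨O, hO, rfl⟩ := isOpen_induced_iff.1 hU
  obtain ⟨t, ht⟩ := hne
  have hpos : 0 < volume (O ∩ {t : Fin d → ℝ | (∀ i, 0 < t i) ∧ ∑ i, t i < 1}) :=
    (hO.inter (isOpen_posSimplex d)).measure_pos _ (exists_pos_mem_of_isOpen hO t.2 ht)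
  rw [refMeasure_apply] at h0
  refine hpos.ne' (measure_mono_null ?_ h0)
  rintro s ⟨hs, hs'⟩
  exact ⟨⟨s, posSimplex_subset_refSimplex d hs'⟩, hs, rfl⟩

theorem dense_pos (d : ℕ) :
    Dense {t : refSimplex d | (∀ i, 0 < (t : Fin d → ℝ) i) ∧ ∑ i, (t : Fin d → ℝ) i < 1} := by
  intro t
  rw [mem_closure_iff]
  intro U hU ht
  obtain ⟨O, hO, rfl⟩ := isOpen_induced_iff.1 hU
  obtain ⟨s, hs, hs'⟩ := exists_pos_mem_of_isOpen hO t.2 ht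
  exact ⟨⟨s, posSimplex_subset_refSimplex d hs'⟩, hs, hs'⟩

theorem integrable_refMeasure {d : ℕ} {g : refSimplex d → ℝ} (hg : Continuous g) :
    Integrable g (refMeasure d) :=
  hg.integrable_of_hasCompactSupport (HasCompactSupport.of_compactSpace g)

theorem eq_zero_of_integral_eq_zero {d : ℕ} {g : refSimplex d → ℝ} (hg : Continuous g)
    (h0 : ∀ t, 0 ≤ g t) (h : ∫ t, g t ∂(refMeasure d) = 0) : g = 0 := by
  rw [integral_eq_zero_iff_of_nonneg h0 (integrable_refMeasure hg)] at h
  exact (Continuous.ae_eq_iff_eq _ hg continuous_const).1 h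

end ReferenceSimplex

/-! ### Forms with continuous coefficients, for integrability. -/

section Continuity

/-- The forms with continuous coefficients. -/
def contForms {n : ℕ} (X : Set (E n)) (W : Type*) [AddCommGroup W] [Module ℝ W] (k : ℕ) :
    Submodule ℝ (DForm X W k) where
  carrier := {ω | ∀ w, Continuous fun x => ω x w}
  add_mem' ha hb w := (ha w).add (hb w)
  zero_mem' _ := continuous_const
  smul_mem' c _ ha w := (ha w).const_smul c

variable {n : ℕ}

theorem polyForms_le_contForms (X : Set (E n)) (W : Type*) [AddCommGroup W] [Module ℝ W]
    (s : ℤ) (k : ℕ) : polyForms X W s k ≤ contForms X W k := by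
  rw [polyForms, Submodule.span_le]
  rintro _ ⟨p, α, -, rfl⟩ w
  have h : Continuous fun x : X => p.eval fun i => (x : E n) i :=
    (MvPolynomial.continuous_eval p).comp (by fun_prop)
  exact h.mul continuous_const

theorem continuous_bary (T : Affine.Simplex ℝ (E n) n) (i : Fin (n + 1)) :
    Continuous (bary T i) := (bary T i).continuous_of_finiteDimensional

theorem polyMinusForms_le_contForms (T : Affine.Simplex ℝ (E n) n) {r : ℕ} (hr : 1 ≤ r) (k : ℕ) :
    polyMinusForms T.closedInterior r k ≤ contForms T.closedInterior (E n) k := by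
  rw [polyMinusForms_eq_span T hr, Submodule.span_le]
  rintro _ ⟨β, v, -, rfl⟩ w
  have h : ∀ i, Continuous fun x : T.closedInterior => bary T i (x : E n) := fun i =>
    (continuous_bary T i).comp continuous_subtype_val
  simp only [monWhitney, whitney_eq_sum, AlternatingMap.smul_apply, alternatingMap_sum_apply,
    smul_eq_mul]
  fun_prop

theorem trace_mem_contForms {X Y : Set (E n)} {k : ℕ} (h : Y ⊆ X) (W : Submodule ℝ (E n))
    {u : DForm X (E n) k} (hu : u ∈ contForms X (E n) k) : trace h W u ∈ contForms Y W k :=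
  fun w => (hu fun j => w j).comp (continuous_inclusion h)

theorem wedge_mem_contForms {X : Set (E n)} {W : Type*} [AddCommGroup W] [Module ℝ W] {k l : ℕ}
    {a : DForm X W k} {b : DForm X W l} (ha : a ∈ contForms X W k) (hb : b ∈ contForms X W l) :
    (fun x => wedge (a x) (b x)) ∈ contForms X W (k + l) := by
  intro w
  simp only [wedge_apply]
  refine continuous_finsetSum _ fun σ _ => ?_
  induction σ using Quotient.inductionOn' with | _ σ
  have h : ∀ x, LinearMap.mul' ℝ ℝ (AlternatingMap.domCoprod.summand (a x) (b x)
      (Quotient.mk'' σ) (w ∘ finSumFinEquiv)) = ((Equiv.Perm.sign σ : ℤ) : ℝ) *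
        (a x (fun i => w (finSumFinEquiv (σ (Sum.inl i)))) *
          b x (fun i => w (finSumFinEquiv (σ (Sum.inr i))))) := by
    intro x
    rw [AlternatingMap.domCoprod.summand_mk'', Units.smul_def, _root_.smul_apply, map_zsmul,
      zsmul_eq_mul]
    rfl
  simp only [h]
  exact continuous_const.mul ((ha _).mul (hb _))

theorem continuous_param {d : ℕ} (S : Affine.Simplex ℝ (E n) d) : Continuous (param S) := by
  refine Continuous.subtype_mk (continuous_const.add (continuous_finsetSum _ fun i _ => ?_)) _
  exact ((continuous_apply i).comp continuous_subtype_val).smul continuous_const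

theorem continuous_integrand {d : ℕ} (S : Affine.Simplex ℝ (E n) d)
    {ω : DForm S.closedInterior (tangent S) d} (hω : ω ∈ contForms _ _ d) :
    Continuous fun t => ω (param S t) (frame S) := (hω _).comp (continuous_param S)

theorem formIntegral_add {d : ℕ} (S : Affine.Simplex ℝ (E n) d)
    (o : Orientation ℝ (tangent S) (Fin d)) {ω η : DForm S.closedInterior (tangent S) d}
    (hω : ω ∈ contForms _ _ d) (hη : η ∈ contForms _ _ d) :
    formIntegral S o (ω + η) = formIntegral S o ω + formIntegral S o η := by
  rw [formIntegral, formIntegral, formIntegral, ← mul_add, ← integral_add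
    (integrable_refMeasure (continuous_integrand S hω))
    (integrable_refMeasure (continuous_integrand S hη))]
  rfl

theorem formIntegral_smul {d : ℕ} (S : Affine.Simplex ℝ (E n) d)
    (o : Orientation ℝ (tangent S) (Fin d)) (c : ℝ) (ω : DForm S.closedInterior (tangent S) d) :
    formIntegral S o (c • ω) = c * formIntegral S o ω := by
  simp only [formIntegral, Pi.smul_apply, AlternatingMap.smul_apply, smul_eq_mul,
    integral_const_mul]
  ring

end Continuity

/-! ### Injectivity and a dimension bound give bijectivity. -/

section LinearAlgebra

variable {X V : Type*} [AddCommMonoid X] [Module ℝ X] [AddCommMonoid V] [Module ℝ V]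

theorem injective_of_map_eq_zero (D : X →ₗ[ℝ] V) (h : ∀ x, D x = 0 → x = 0) :
    Function.Injective D := by
  let _ : AddCommGroup X := Module.addCommMonoidToAddCommGroup ℝ
  let _ : AddCommGroup V := Module.addCommMonoidToAddCommGroup ℝ
  exact (injective_iff_map_eq_zero D).2 h

/-- An injective linear map to the dual of a space of at most the same dimension is bijective. -/
theorem bijective_of_injective_of_finrank_le [Module.Finite ℝ V] (D : X →ₗ[ℝ] Module.Dual ℝ V)
    (hD : Function.Injective D)
    (hle : Module.Finite ℝ X → Module.finrank ℝ V ≤ Module.finrank ℝ X) :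
    Function.Bijective D := by
  let _ : AddCommGroup X := Module.addCommMonoidToAddCommGroup ℝ
  let _ : AddCommGroup V := Module.addCommMonoidToAddCommGroup ℝ
  have hX : Module.Finite ℝ X := Module.Finite.of_injective D hD
  refine ⟨hD, (LinearMap.injective_iff_surjective_of_finrank_eq_finrank ?_).1 hD⟩
  refine le_antisymm (LinearMap.finrank_le_finrank_of_injective hD) ?_
  rw [Subspace.dual_finrank_eq]
  exact hle hX

end LinearAlgebra

/-! ### The degrees of freedom and unisolvence. -/

section DegreesOfFreedom

variable {n k : ℕ} (T : Affine.Simplex ℝ (E n) n)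

/-- The edge vectors form a basis of the tangent space, on which a nonzero top-degree form cannot
vanish. -/
theorem sign_someVector_ne_zero (f : Face n k)
    (o : Orientation ℝ (tangent (f.simplex T)) (Fin f.dim)) :
    Real.sign (o.someVector (frame (f.simplex T))) ≠ 0 := by
  obtain ⟨B, hB, -⟩ := exists_basis_frame T f
  rw [Ne, Real.sign_eq_zero_iff, ← funext hB, AlternatingMap.map_basis_eq_zero_iff]
  exact o.someVector_ne_zero

/-- The pairing of the extension of a test form with the test form itself is definite. -/
theorem eq_zero_of_dof_faceExt_eq_zero (f : Face n k)
    (o : Orientation ℝ (tangent (f.simplex T)) (Fin f.dim)) {r : ℕ} (hr : 1 ≤ r)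
    {q : DForm (f.simplex T).closedInterior (tangent (f.simplex T)) f.l}
    (hq : q ∈ testForms T r f) (h : dof T f o q (faceExt T f (r - 1 - f.l) q) = 0) : q = 0 := by
  have hu := polyMinusForms_le_contForms T hr k (faceExt_mem T f hr hq)
  have hqc := polyForms_le_contForms _ _ _ _ hq
  have hcont := continuous_integrand (f.simplex T)
    (wedge_mem_contForms (trace_mem_contForms (f.subset T) (tangent (f.simplex T)) hu) hqc)
  rw [dof, formIntegral, mul_eq_zero, or_iff_right (sign_someVector_ne_zero T f o)] at h
  have hle := fun t => sum_sq_le_wedge_trace_faceExt T f (r - 1 - f.l) q (param (f.simplex T) t)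
  have hterm : ∀ (t : refSimplex f.dim) (v : Fin k → Fin f.dim),
      0 ≤ offProd (fbary T f (param (f.simplex T) t : E n)) (zeroCons v) *
        fbary T f (param (f.simplex T) t : E n) 0 *
          cof T f (Fin.succ ∘ v) (q (param (f.simplex T) t)) ^ 2 := by
    intro t v
    have h0 := fun j => fbary_nonneg T f (f.subset T (param (f.simplex T) t).2) j
    exact mul_nonneg (mul_nonneg (offProd_nonneg h0 _) (h0 0)) (sq_nonneg _)
  have hzero := eq_zero_of_integral_eq_zero hcont
    (fun t => (Finset.sum_nonneg fun v _ => hterm t v).trans (hle t)) h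
  -- The integrand is nonnegative and continuous, hence zero. In the open simplex all weights of the
  -- squares are positive, so every coefficient of `q` vanishes there; density extends this to the
  -- boundary.
  have hpos : ∀ t : refSimplex f.dim, ((∀ i, 0 < (t : Fin f.dim → ℝ) i) ∧
      ∑ i, (t : Fin f.dim → ℝ) i < 1) → q (param (f.simplex T) t) = 0 := by
    intro t ht
    have hlam : ∀ j, 0 < fbary T f (param (f.simplex T) t : E n) j := by
      intro j
      rw [fbary_param]
      refine Fin.cases ?_ (fun j => ?_) j
      · simpa using ht.2
      · simpa using ht.1 j
    refine eq_zero_of_cof_eq_zero T f fun v => ?_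
    have h1 := (hle t).trans (congrFun hzero t).le
    have h2 := (Finset.sum_eq_zero_iff_of_nonneg fun v _ => hterm t v).1
      (le_antisymm h1 (Finset.sum_nonneg fun v _ => hterm t v)) v (Finset.mem_univ v)
    have h3 := mul_pos (offProd_pos hlam (zeroCons v)) (hlam 0)
    exact pow_eq_zero_iff two_ne_zero |>.1 ((mul_eq_zero.1 h2).resolve_left h3.ne')
  funext y
  ext w
  rw [← param_projParam T f y]
  exact congrFun (Continuous.ext_on (dense_pos f.dim) ((hqc w).comp (continuous_param _))
    (continuous_const (y := (0 : ℝ))) fun t ht => by simp [hpos t ht]) _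

theorem dof_eq_zero_of_trace_eq_zero (f : Face n k)
    (o : Orientation ℝ (tangent (f.simplex T)) (Fin f.dim))
    (q : DForm (f.simplex T).closedInterior (tangent (f.simplex T)) f.l)
    {u : DForm T.closedInterior (E n) k}
    (hu : trace (f.subset T) (tangent (f.simplex T)) u = 0) : dof T f o q u = 0 := by
  have : ∀ x, wedge (trace (f.subset T) (tangent (f.simplex T)) u x) (q x) = 0 := by
    intro x
    rw [hu, Pi.zero_apply, ← wedgeₗ_apply, map_zero, LinearMap.zero_apply]
  simp [dof, formIntegral, this]

section Linearity

variable {T} {f : Face n k} (o : Orientation ℝ (tangent (f.simplex T)) (Fin f.dim))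
  {q q' : DForm (f.simplex T).closedInterior (tangent (f.simplex T)) f.l}
  {u u' : DForm T.closedInterior (E n) k}

theorem wedge_trace_mem_contForms (hq : q ∈ contForms _ _ _) (hu : u ∈ contForms _ _ _) :
    (fun x => wedge (trace (f.subset T) (tangent (f.simplex T)) u x) (q x)) ∈
      contForms _ (tangent (f.simplex T)) f.dim :=
  wedge_mem_contForms (trace_mem_contForms (f.subset T) (tangent (f.simplex T)) hu) hq

theorem dof_add_left (hq : q ∈ contForms _ _ _) (hq' : q' ∈ contForms _ _ _)
    (hu : u ∈ contForms _ _ _) : dof T f o (q + q') u = dof T f o q u + dof T f o q' u := by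
  have h : (fun x => wedge (trace (f.subset T) (tangent (f.simplex T)) u x) ((q + q') x)) =
      (fun x => wedge (trace (f.subset T) (tangent (f.simplex T)) u x) (q x)) +
        fun x => wedge (trace (f.subset T) (tangent (f.simplex T)) u x) (q' x) :=
    funext fun x => wedge_add (trace (f.subset T) (tangent (f.simplex T)) u x) (q x) (q' x)
  rw [dof, h, formIntegral_add _ _ (wedge_trace_mem_contForms hq hu)
    (wedge_trace_mem_contForms hq' hu)]
  rfl

theorem dof_smul_left (c : ℝ) : dof T f o (c • q) u = c * dof T f o q u := by
  have h : (fun x => wedge (trace (f.subset T) (tangent (f.simplex T)) u x) ((c • q) x)) =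
      c • fun x => wedge (trace (f.subset T) (tangent (f.simplex T)) u x) (q x) :=
    funext fun x => wedge_smul c (trace (f.subset T) (tangent (f.simplex T)) u x) (q x)
  rw [dof, h, formIntegral_smul]
  rfl

theorem dof_add_right (hq : q ∈ contForms _ _ _) (hu : u ∈ contForms _ _ _)
    (hu' : u' ∈ contForms _ _ _) : dof T f o q (u + u') = dof T f o q u + dof T f o q u' := by
  have h : (fun x => wedge (trace (f.subset T) (tangent (f.simplex T)) (u + u') x) (q x)) =
      (fun x => wedge (trace (f.subset T) (tangent (f.simplex T)) u x) (q x)) +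
        fun x => wedge (trace (f.subset T) (tangent (f.simplex T)) u' x) (q x) :=
    funext fun x => add_wedge (trace (f.subset T) (tangent (f.simplex T)) u x)
      (trace (f.subset T) (tangent (f.simplex T)) u' x) (q x)
  rw [dof, h, formIntegral_add _ _ (wedge_trace_mem_contForms hq hu)
    (wedge_trace_mem_contForms hq hu')]
  rfl

theorem dof_smul_right (c : ℝ) : dof T f o q (c • u) = c * dof T f o q u := by
  have h : (fun x => wedge (trace (f.subset T) (tangent (f.simplex T)) (c • u) x) (q x)) =
      c • fun x => wedge (trace (f.subset T) (tangent (f.simplex T)) u x) (q x) :=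
    funext fun x => smul_wedge c (trace (f.subset T) (tangent (f.simplex T)) u x) (q x)
  rw [dof, h, formIntegral_smul]
  rfl

end Linearity

theorem testForms_le_contForms (r : ℕ) (f : Face n k) : testForms T r f ≤ contForms _ _ _ :=
  polyForms_le_contForms _ _ _ _

/-- The degrees of freedom as a bilinear map. -/
def dofₗ (f : Face n k) (o : Orientation ℝ (tangent (f.simplex T)) (Fin f.dim)) {r : ℕ}
    (hr : 1 ≤ r) :
    testForms T r f →ₗ[ℝ] Module.Dual ℝ (polyMinusForms T.closedInterior r k) :=
  LinearMap.mk₂ ℝ (fun q u => dof T f o q.1 u.1)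
    (fun q q' u => dof_add_left o (testForms_le_contForms T r f q.2)
      (testForms_le_contForms T r f q'.2) (polyMinusForms_le_contForms T hr k u.2))
    (fun c _ _ => dof_smul_left o c)
    (fun q u u' => dof_add_right o (testForms_le_contForms T r f q.2)
      (polyMinusForms_le_contForms T hr k u.2) (polyMinusForms_le_contForms T hr k u'.2))
    (fun c _ _ => dof_smul_right o c)

theorem Face.eq_of_verts_eq {f g : Face n k} (h : f.verts = g.verts) : f = g := by
  obtain ⟨l, F, hF⟩ := f
  obtain ⟨l', F', hF'⟩ := g
  obtain rfl : F = F' := h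
  obtain rfl : l = l' := by omega
  rfl

instance : Finite (Face n k) :=
  Finite.of_injective (fun f : Face n k => f.verts) fun _ _ => Face.eq_of_verts_eq

instance : Fintype (Face n k) := Fintype.ofFinite _

instance : DecidableEq (Face n k) := Classical.decEq _

variable (k) in
/-- The functional on `𝒫_r⁻ Λᵏ(T)` defined by a family of test forms. -/
def totalDof (o : ∀ f : Face n k, Orientation ℝ (tangent (f.simplex T)) (Fin f.dim)) {r : ℕ}
    (hr : 1 ≤ r) :
    (∀ f : Face n k, testForms T r f) →ₗ[ℝ]
      Module.Dual ℝ (polyMinusForms T.closedInterior r k) :=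
  ∑ f : Face n k, dofₗ T f (o f) hr ∘ₗ LinearMap.proj f

theorem totalDof_apply (o : ∀ f : Face n k, Orientation ℝ (tangent (f.simplex T)) (Fin f.dim))
    {r : ℕ} (hr : 1 ≤ r) (q : ∀ f : Face n k, testForms T r f)
    (u : polyMinusForms T.closedInterior r k) :
    totalDof k T o hr q u = ∑ f : Face n k, dof T f (o f) (q f) u := by
  simp only [totalDof, LinearMap.sum_apply]
  rfl

/-- Take a face `f` of largest dimension with nonzero component and test against the extension of
that component. Faces not containing `f` contribute zero because the trace vanishes, and larger
faces because their components are zero. The remaining pairing on `f` is definite. -/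
theorem totalDof_injective
    (o : ∀ f : Face n k, Orientation ℝ (tangent (f.simplex T)) (Fin f.dim)) {r : ℕ} (hr : 1 ≤ r) :
    Function.Injective (totalDof k T o hr) := by
  refine injective_of_map_eq_zero _ fun q hq => ?_
  classical
  by_contra hne
  obtain ⟨f₀, hf₀⟩ := Function.ne_iff.1 hne
  obtain ⟨f, hf, hmax⟩ := Finset.exists_max_image (Finset.univ.filter fun f => q f ≠ 0)
    (fun f : Face n k => f.l) ⟨f₀, by simpa using hf₀⟩
  rw [Finset.mem_filter] at hf
  apply hf.2
  have h := LinearMap.congr_fun hq ⟨_, faceExt_mem T f hr (q f).2⟩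
  rw [totalDof_apply, Finset.sum_eq_single f, LinearMap.zero_apply] at h
  · exact Subtype.ext (eq_zero_of_dof_faceExt_eq_zero T f (o f) hr (q f).2 h)
  · intro g _ hgf
    by_cases hfg : f.verts ⊆ g.verts
    · have hlt : f.l < g.l := by
        have := Finset.card_lt_card (hfg.ssubset_of_ne fun h => hgf (Face.eq_of_verts_eq h).symm)
        rw [f.card_verts, g.card_verts] at this
        omega
      have hg : q g = 0 := by
        by_contra hg
        exact absurd (hmax g (by simpa using hg)) (not_le.2 hlt)
      have := LinearMap.map_zero₂ (dofₗ T g (o g) hr) ⟨_, faceExt_mem T f hr (q f).2⟩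
      rw [hg]
      exact this
    · exact dof_eq_zero_of_trace_eq_zero T g (o g) _ (trace_faceExt_eq_zero T f _ _ g hfg)
  · simp

theorem finiteDimensional_polyMinusForms {r : ℕ} (hr : 1 ≤ r) :
    Module.Finite ℝ (polyMinusForms T.closedInterior r k) := by
  rw [polyMinusForms_eq_span T hr]
  apply FiniteDimensional.span_of_finite
  have hfin : ({β : Fin (n + 1) → ℕ | ∑ i, β i = r - 1}).Finite := by
    refine (Set.finite_Iic (fun _ : Fin (n + 1) => r - 1)).subset fun β hβ i => ?_
    rw [Set.mem_ofPred_eq] at hβ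
    rw [← hβ]
    exact Finset.single_le_sum (f := β) (fun _ _ => Nat.zero_le _) (Finset.mem_univ i)
  refine ((hfin.prod (Set.finite_univ (α := Fin (k + 1) → Fin (n + 1)))).image
    fun p => monWhitney T p.1 p.2).subset ?_
  rintro _ ⟨β, v, hβ, rfl⟩
  exact ⟨(β, v), ⟨hβ, trivial⟩, rfl⟩

/-- The sum of the extension operators maps the product of the test spaces onto a space containing
`𝒫_r⁻ Λᵏ(T)`. -/
theorem finrank_polyMinusForms_le {r : ℕ} (hr : 1 ≤ r)
    [Module.Finite ℝ (∀ f : Face n k, testForms T r f)] :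
    Module.finrank ℝ (polyMinusForms T.closedInterior r k) ≤
      Module.finrank ℝ (∀ f : Face n k, testForms T r f) := by
  let U : (∀ f : Face n k, testForms T r f) →ₗ[ℝ] DForm T.closedInterior (E n) k :=
    ∑ f : Face n k, faceExt T f (r - 1 - f.l) ∘ₗ (testForms T r f).subtype ∘ₗ LinearMap.proj f
  have hU : polyMinusForms T.closedInterior r k ≤ LinearMap.range U := by
    rw [← extSpan_eq_polyMinusForms T hr]
    refine iSup_le fun f => ?_
    rintro _ ⟨q, hq, rfl⟩
    refine ⟨Pi.single f ⟨q, hq⟩, ?_⟩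
    simp only [U, LinearMap.sum_apply, LinearMap.comp_apply, LinearMap.proj_apply]
    rw [Finset.sum_eq_single f]
    · simp
    · intro g _ hg
      rw [Pi.single_eq_of_ne hg, map_zero, map_zero]
    · simp
  exact (Submodule.finrank_mono hU).trans (LinearMap.finrank_range_le U)

theorem totalDof_bijective
    (o : ∀ f : Face n k, Orientation ℝ (tangent (f.simplex T)) (Fin f.dim)) {r : ℕ} (hr : 1 ≤ r) :
    Function.Bijective (totalDof k T o hr) := by
  have := finiteDimensional_polyMinusForms T hr (k := k)
  exact bijective_of_injective_of_finrank_le _ (totalDof_injective T o hr)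
    fun _ => finrank_polyMinusForms_le T hr

end DegreesOfFreedom

end FEForms

end

theorem mainTheorem1 (n k r : ℕ) (hr : 1 ≤ r) (hk : k ≤ n)
    (T : Affine.Simplex ℝ (FEForms.E n) n)
    (o : ∀ f : FEForms.Face n k,
      Orientation ℝ (FEForms.tangent (f.simplex T)) (Fin f.dim))
    (ι : FEForms.Face n k → Type*)
    (q : ∀ f : FEForms.Face n k, Module.Basis (ι f) ℝ (FEForms.testForms T r f)) :
    ∃ B : Module.Basis (Σ f : FEForms.Face n k, ι f) ℝ
        (Module.Dual ℝ (FEForms.polyMinusForms T.closedInterior r k)),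
      ∀ (f : FEForms.Face n k) (i : ι f) (u : FEForms.polyMinusForms T.closedInterior r k),
        B ⟨f, i⟩ u = FEForms.dof T f (o f) (q f i) u := by
  -- The chosen bases form a basis of the product of the test spaces, and the bijection carries it
  -- to the functionals: an element with a single nonzero component picks out one face of the sum.
  refine ⟨(Pi.basis q).map (LinearEquiv.ofBijective _ (FEForms.totalDof_bijective T o hr)),
    fun f i u => ?_⟩
  rw [Module.Basis.map_apply, Pi.basis_apply, LinearEquiv.ofBijective_apply,
    FEForms.totalDof_apply, Finset.sum_eq_single f]
  · rw [Pi.single_eq_same]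
  · intro g _ hg
    rw [Pi.single_eq_of_ne hg]
    exact LinearMap.map_zero₂ (FEForms.dofₗ T g (o g) hr) u
  · simp
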